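/- Let $d\ge 1$. For $k\ge 1$ let $\mathcal F_k^{\otimes}$ be the space, with the supremum norm, of continuous functions $f:(\mathbb R^{2d})^k\to\mathbb R$ which are diagonally translation invariant, $f(x_1+a,y_1+a,\dots,x_k+a,y_k+a)=f(x_1,y_1,\dots,x_k,y_k)$ for all $a\in\mathbb R^d$, and which vanish at infinity in the sense that $f(x_1,y_1,\dots,x_k,y_k)\to 0$ as $\max_{i,j}\{|x_i-y_j|,|x_i-x_j|,|y_i-y_j|\}\to\infty$ (such functions are bounded). Let $\mathcal F^\otimes=\bigcup_{k\ge1}\mathcal F_k^\otimes$ (disjoint union) and let $(f_r)_{r\ge 1}$ be any sequence in $\mathcal F^\otimes$, $f_r\in\mathcal F^\otimes_{k_r}$, which is dense in $\mathcal F^\otimes$, i.e. whose members in $\mathcal F_k^\otimes$ are dense in $\mathcal F_k^\otimes$ for every $k$. For finite measures $\alpha,\beta$ on $\mathbb R^d$ let $\widetilde{\alpha\beta}=\{(\alpha\star\delta_x)\otimes(\beta\star\delta_x):x\in\mathbb R^d\}$ be the diagonal orbit of the product measure $\alpha\otimes\beta$. Let $\widetilde{\mathcal M}_1^\otimes$ be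 the set of the orbits $\widetilde{\mu\nu}$ with $\mu,\nu$ probability measures on $\mathbb R^d$, with the quotient of the product of the weak topologies. Let $\widetilde{\mathcal X}^\otimes$ be the set of all empty, finite or countable collections (repetitions allowed) $\xi=\{\widetilde{\alpha_j\beta_j}\}_j$ of diagonal orbits of products of sub-probability measures which can be written with $\sum_j\alpha_j(\mathbb R^d)\le 1$ and $\sum_j\beta_j(\mathbb R^d)\le1$; members with $\alpha_j\otimes\beta_j=0$ are disregarded. The orbit $\widetilde{\mu\nu}\in\widetilde{\mathcal M}_1^\otimes$ is identified with the collection $\{\widetilde{\mu\nu}\}$. For $f\in\mathcal F_k^\otimes$ put $$\Lambda^\otimes(f,\xi)=\sum_{j}\int f(x_1,y_1,\dots,x_k,y_k)\prod_{i=1}^k(\alpha_j\otimes\beta_j)(\mathrm dx_i\,\mathrm dy_i),$$ $$\mathbf D^\otimes(\xi_1,\xi_2)=\sum_{r=1}^\infty\frac1{2^r}\,\frac1{1+\|f_r\|_\infty}\,\big|\Lambda^\otimes(f_r,\xi_1)-\Lambda^\otimes(f_r,\xi_2)\big|.$$ Then $\mathbf D^\otimes$ is a metric on $\widetilde{\mathcal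 X}^\otimes$, and in the metric space $(\widetilde{\mathcal X}^\otimes,\mathbf D^\otimes)$ the following hold. Every sequence in $\widetilde{\mathcal M}_1^\otimes$ has a subsequence that converges to a limit in $\widetilde{\mathcal X}^\otimes$. The set $\widetilde{\mathcal M}_1^\otimes$ is dense in $\widetilde{\mathcal X}^\otimes$. The space $\widetilde{\mathcal X}^\otimes$ is a compactification of $\widetilde{\mathcal M}_1^\otimes$: it is compact, and the inclusion $\widetilde{\mathcal M}_1^\otimes\hookrightarrow\widetilde{\mathcal X}^\otimes$ is a homeomorphism onto its (dense) image. Moreover $\widetilde{\mathcal X}^\otimes$ is the completion of $\widetilde{\mathcal M}_1^\otimes$ under $\mathbf D^\otimes$: $\widetilde{\mathcal X}^\otimes$ is complete, and $\widetilde{\mathcal M}_1^\otimes$ is totally bounded and dense in it. -/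

import Mathlib

open MeasureTheory Filter Topology
open scoped BoundedContinuousFunction

noncomputable section

namespace PairCompactification

/-- The Euclidean space `ℝ^d`. -/
abbrev E (d : ℕ) : Type := EuclideanSpace ℝ (Fin d)

/-- The diagonal shift `((x₁, y₁), …, (x_k, y_k)) ↦ ((x₁ + a, y₁ + a), …, (x_k + a, y_k + a))`. -/
def diagShift {d k : ℕ} (a : E d) (z : Fin k → E d × E d) : Fin k → E d × E d :=
  fun i => ((z i).1 + a, (z i).2 + a)

/-- The diameter `max_{i,j} {|x_i - y_j|, |x_i - x_j|, |y_i - y_j|}` of the finite set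
`{x₁, y₁, …, x_k, y_k}`. -/
def spread {d k : ℕ} (z : Fin k → E d × E d) : ℝ :=
  Metric.diam (Set.range (fun i => (z i).1) ∪ Set.range (fun i => (z i).2))

/-- The test functions of `k` pairs: continuous functions on `(ℝ^{2d})^k` that are diagonally
translation invariant and tend to `0` as the diameter of the configuration tends to infinity.
Such a function is automatically bounded, so the space is realised inside the bounded continuous
functions, with the supremum norm. -/
def testFunctions (d k : ℕ) : Set ((Fin k → E d × E d) →ᵇ ℝ) :=
  {f | (∀ (a : E d) (z : Fin k → E d × E d), f (diagShift a z) = f z) ∧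
    Tendsto f (comap spread atTop) (𝓝 0)}

/-- The union over `k ≥ 1` of the spaces of test functions of `k` pairs, with the topology of the
disjoint union (each piece carries the supremum norm). -/
abbrev TestFunction (d : ℕ) : Type := Σ k : ℕ+, testFunctions d (k : ℕ)

/-- The translate `μ ⋆ δ_x`. -/
def translate {d : ℕ} (μ : Measure (E d)) (x : E d) : Measure (E d) :=
  μ.map (fun y => y + x)

/-- The diagonal orbit `{(α ⋆ δ_x) ⊗ (β ⋆ δ_x) : x ∈ ℝ^d}` of the product measure `α ⊗ β`. -/
def diagOrbit {d : ℕ} (α β : Measure (E d)) : Set (Measure (E d × E d)) :=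
  Set.range fun x : E d => (translate α x).prod (translate β x)

/-- `∫ f(x₁, y₁, …, x_k, y_k) ∏_i (α ⊗ β)(dx_i dy_i)`. -/
def pairIntegral {d : ℕ} (f : TestFunction d) (α β : Measure (E d)) : ℝ :=
  ∫ z, (f.2 : (Fin (f.1 : ℕ) → E d × E d) →ᵇ ℝ) z
    ∂(Measure.pi fun _ : Fin (f.1 : ℕ) => α.prod β)

/-- The space of diagonal orbits of products `μ ⊗ ν` of probability measures (such a product
determines `μ` and `ν`), with the quotient of the product of the weak topologies. -/
abbrev ProductOrbit (d : ℕ) : Type :=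
  Quotient (Setoid.ker fun p : ProbabilityMeasure (E d) × ProbabilityMeasure (E d) =>
    diagOrbit (p.1 : Measure (E d)) (p.2 : Measure (E d)))

/-- A sequence of pairs of measures with `∑ α_i(ℝ^d) ≤ 1` and `∑ β_i(ℝ^d) ≤ 1`. Terms with
`α_i ⊗ β_i = 0` stand for absent members, so that empty and finite families are included. -/
structure PairFamily (d : ℕ) where
  α : ℕ → FiniteMeasure (E d)
  β : ℕ → FiniteMeasure (E d)
  sum_α : ∑' i, (α i : Measure (E d)) Set.univ ≤ 1
  sum_β : ∑' i, (β i : Measure (E d)) Set.univ ≤ 1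

namespace PairFamily

variable {d : ℕ}

/-- The product measure `α_i ⊗ β_i`. -/
def prod (F : PairFamily d) (i : ℕ) : Measure (E d × E d) :=
  (F.α i : Measure (E d)).prod (F.β i : Measure (E d))

/-- The diagonal orbit of `α_i ⊗ β_i`. -/
def orbit (F : PairFamily d) (i : ℕ) : Set (Measure (E d × E d)) :=
  diagOrbit (F.α i : Measure (E d)) (F.β i : Measure (E d))

/-- Two families have the same collection (with multiplicity) of nonzero diagonal orbits. -/
def SameOrbits (F G : PairFamily d) : Prop :=
  ∃ e : {i // F.prod i ≠ 0} ≃ {i // G.prod i ≠ 0}, ∀ i, G.orbit (e i) = F.orbit i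

/-- Having the same collection of orbits is an equivalence relation. -/
instance setoid (d : ℕ) : Setoid (PairFamily d) where
  r := SameOrbits
  iseqv :=
    { refl := fun F => ⟨Equiv.refl _, fun _ => rfl⟩
      symm := by
        rintro F G ⟨e, he⟩
        exact ⟨e.symm, fun i => by rw [← he (e.symm i), e.apply_symm_apply]⟩
      trans := by
        rintro F G H ⟨e, he⟩ ⟨e', he'⟩
        exact ⟨e.trans e', fun i => by rw [Equiv.trans_apply, he', he]⟩ }

/-- The family whose only member is `μ ⊗ ν`. -/
def single (μ ν : ProbabilityMeasure (E d)) : PairFamily d where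
  α := fun i => if i = 0 then μ.toFiniteMeasure else 0
  β := fun i => if i = 0 then ν.toFiniteMeasure else 0
  sum_α := by
    rw [tsum_eq_single 0 (fun i hi => by simp [hi])]
    simp
  sum_β := by
    rw [tsum_eq_single 0 (fun i hi => by simp [hi])]
    simp

theorem single_prod_ne_zero (μ ν : ProbabilityMeasure (E d)) (i : ℕ) :
    (single μ ν).prod i ≠ 0 ↔ i = 0 := by
  constructor
  · intro h
    by_contra hi
    exact h (by simp [prod, single, hi])
  · rintro rfl
    have : (single μ ν).prod 0 = (μ : Measure (E d)).prod (ν : Measure (E d)) := by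
      simp [prod, single]
    rw [this]
    exact IsProbabilityMeasure.ne_zero _

end PairFamily

/-- The space of all empty, finite or countable collections (with multiplicity) of diagonal orbits
of nonzero products `α_i ⊗ β_i` with `∑ α_i(ℝ^d) ≤ 1` and `∑ β_i(ℝ^d) ≤ 1`. -/
def X (d : ℕ) : Type := Quotient (PairFamily.setoid d)

/-- The canonical map from orbits of products of probability measures to collections of orbits:
`μ ⊗ ν` goes to the collection whose only member is its orbit. -/
def ofOrbit {d : ℕ} : ProductOrbit d → X d :=
  Quotient.lift (fun p => (Quotient.mk (PairFamily.setoid d) (PairFamily.single p.1 p.2) : X d))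
    (by
      rintro ⟨μ, ν⟩ ⟨μ', ν'⟩ h
      refine Quotient.sound ⟨Equiv.subtypeEquivRight fun i => ?_, ?_⟩
      · rw [PairFamily.single_prod_ne_zero, PairFamily.single_prod_ne_zero]
      · rintro ⟨i, hi⟩
        obtain rfl := (PairFamily.single_prod_ne_zero μ ν i).1 hi
        exact Eq.symm h)

theorem translate_zero {d : ℕ} (μ : Measure (E d)) : translate μ 0 = μ := by
  simp [translate]

/-- The integral of a test function depends only on the diagonal orbit of the product. -/
theorem pairIntegral_congr {d : ℕ} (f : TestFunction d) (α β α' β' : FiniteMeasure (E d))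
    (h : diagOrbit (α : Measure (E d)) β = diagOrbit (α' : Measure (E d)) β') :
    pairIntegral f α β = pairIntegral f α' β' := by
  have hmem : (α' : Measure (E d)).prod (β' : Measure (E d)) ∈ diagOrbit (α : Measure (E d)) β := by
    rw [h]
    exact ⟨0, by simp only [translate_zero]⟩
  obtain ⟨a, ha⟩ := hmem
  have hm : Measurable (fun y : E d => y + a) := measurable_add_const a
  have hmap : (α' : Measure (E d)).prod (β' : Measure (E d)) =
      ((α : Measure (E d)).prod (β : Measure (E d))).map
        (Prod.map (fun y => y + a) (fun y => y + a)) := by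
    rw [← ha]
    exact Measure.map_prod_map _ _ hm hm
  have hm2 : Measurable (Prod.map (fun y : E d => y + a) (fun y : E d => y + a)) :=
    hm.prodMap hm
  unfold pairIntegral
  have hm3 : Measurable (diagShift (k := (f.1 : ℕ)) a) :=
    measurable_pi_lambda _ fun i => hm2.comp (measurable_pi_apply i)
  have hpi : (Measure.pi fun _ : Fin (f.1 : ℕ) => (α' : Measure (E d)).prod (β' : Measure (E d))) =
      (Measure.pi fun _ : Fin (f.1 : ℕ) =>
        (α : Measure (E d)).prod (β : Measure (E d))).map (diagShift a) := by
    rw [hmap, ← Measure.pi_map_pi (fun _ => hm2.aemeasurable)]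
    rfl
  rw [hpi, integral_map hm3.aemeasurable
      (BoundedContinuousFunction.continuous _).aestronglyMeasurable]
  exact integral_congr_ae (Eventually.of_forall fun z => (f.2.2.1 a z).symm)

theorem pairIntegral_eq_zero {d : ℕ} (f : TestFunction d) (α β : FiniteMeasure (E d))
    (h : (α : Measure (E d)).prod (β : Measure (E d)) = 0) : pairIntegral f α β = 0 := by
  have : Measure.pi (fun _ : Fin (f.1 : ℕ) => (α : Measure (E d)).prod (β : Measure (E d))) = 0 := by
    rw [← Measure.measure_univ_eq_zero, Measure.pi_univ]
    exact Finset.prod_eq_zero (Finset.mem_univ ⟨0, f.1.pos⟩) (by rw [h]; rfl)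
  rw [pairIntegral, this, integral_zero_measure]

/-- `Λ(f, ξ)`: the sum over the orbits in `ξ` of the integrals
`∫ f(x₁, y₁, …, x_k, y_k) ∏_i (α ⊗ β)(dx_i dy_i)`. -/
def Lam {d : ℕ} (f : TestFunction d) : X d → ℝ :=
  Quotient.lift (fun F : PairFamily d => ∑' i, pairIntegral f (F.α i) (F.β i))
    (by
      rintro F G ⟨e, he⟩
      have key : ∀ H : PairFamily d, ∑' i, pairIntegral f (H.α i) (H.β i) =
          ∑' i : {i // H.prod i ≠ 0}, pairIntegral f (H.α i) (H.β i) := by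
        intro H
        refine (tsum_subtype_eq_of_support_subset (s := {i | H.prod i ≠ 0}) ?_).symm
        intro i hi h0
        exact hi (pairIntegral_eq_zero f _ _ h0)
      change ∑' i, pairIntegral f (F.α i) (F.β i) = ∑' i, pairIntegral f (G.α i) (G.β i)
      rw [key F, key G, ← e.tsum_eq]
      exact tsum_congr fun i => pairIntegral_congr f _ _ _ _ (he i).symm)

/-- `D(ξ₁, ξ₂) = ∑_{r ≥ 1} 2^{-r} (1 + ‖f_r‖_∞)^{-1} |Λ(f_r, ξ₁) - Λ(f_r, ξ₂)|` for a sequence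
`f_1, f_2, …` of test functions (here indexed from `0`). -/
def D {d : ℕ} (f : ℕ → TestFunction d) (ξ₁ ξ₂ : X d) : ℝ :=
  ∑' r : ℕ, 1 / 2 ^ (r + 1) *
    (1 / (1 + ‖((f r).2 : (Fin ((f r).1 : ℕ) → E d × E d) →ᵇ ℝ)‖)) *
      |Lam (f r) ξ₁ - Lam (f r) ξ₂|

end PairCompactification

end

/-!
The proof follows collections of orbits along ultrafilters, which makes subsequences unnecessary.

**Limits.** Fix an ultrafilter and pairs `(μ i, ν i)` of probability measures. Call two choices of
centres `a i`, `b i` equivalent if their distance stays bounded along the ultrafilter; otherwise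
the distance tends to infinity. Around every choice of centres the translates of `μ i` and of `ν i`
have vague limits (`exists_vagueLim`, by the Riesz–Markov–Kakutani theorem), and only countably many
classes have nonzero limits, since the masses add up to at most one. The limits around
representatives of the classes form the limit collection (`exists_isProfile`).
That the integrals of test functions converge to those of the limit collection
(`IsProfile.tendsto_pairIntegral`) holds because away from finitely many centres no ball carries
much mass of both measures (`IsProfile.exists_small_away`), so that few pairs of nearby points lie
there (`prod_near_le`), while near a centre the integrand vanishes at infinity and vague convergence
of the product measures applies (`VagueLim.tendsto_integral_pi`).

**Uniqueness.** A product measure `α ⊗ β` seen from a point `x` is encoded by countably many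
integrals, a point `view α β x` of a cube. Draw a pair from `α ⊗ β`, with a weight decaying in the
distance of its two points, and take the view from its first point; summing over the members of a
collection gives a measure on the cube. Its moments are integrals of test functions over the
collection, so it is determined by them, and the mass which it gives to the views of a fixed product
measure counts the members of the collection in the orbit of that measure
(`PairFamily.sameOrbits_of_tsum_eq`). Hence `D` is a metric.

**Conclusion.** Compactness follows from the existence of limits along ultrafilters and from
density. For density, the members of a collection, together with the missing mass of each of the two
sequences as members of zero product, are superposed along diverging centres
(`exists_tendsto_pairIntegral`). For the embedding, if orbits of products of probability measures
converge to such an orbit, then by uniqueness one class of centres carries all the mass, and vague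
convergence without loss of mass is weak convergence (`le_nhds_of_tendsto_Lam`).
-/

namespace PairCompactification

variable {d : ℕ} {ι κ : Type*}

/-! ### Cutoffs and translates -/

instance (μ : Measure (E d)) [IsFiniteMeasure μ] (x : E d) : IsFiniteMeasure (translate μ x) := by
  unfold translate; infer_instance

instance (μ : Measure (E d)) [IsProbabilityMeasure μ] (x : E d) :
    IsProbabilityMeasure (translate μ x) :=
  Measure.isProbabilityMeasure_map (measurable_add_const x).aemeasurable

theorem integral_translate (μ : Measure (E d)) (x : E d) {g : E d → ℝ} (hg : Continuous g) :
    ∫ y, g y ∂translate μ x = ∫ y, g (y + x) ∂μ :=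
  integral_map (measurable_add_const x).aemeasurable hg.aestronglyMeasurable

theorem translate_apply (μ : Measure (E d)) (x : E d) {s : Set (E d)} (hs : MeasurableSet s) :
    translate μ x s = μ ((fun y => y + x) ⁻¹' s) :=
  Measure.map_apply (measurable_add_const x) hs

theorem translate_univ (μ : Measure (E d)) (x : E d) : translate μ x Set.univ = μ Set.univ := by
  rw [translate_apply μ x MeasurableSet.univ, Set.preimage_univ]

/-- The continuous cutoff that is `1` on the ball of radius `R` and `0` outside the ball of radius
`R + 1`. -/
noncomputable def cut (R : ℝ) (x : E d) : ℝ := max 0 (min 1 (R + 1 - ‖x‖))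

theorem continuous_cut (R : ℝ) : Continuous (cut R : E d → ℝ) := by unfold cut; fun_prop

theorem cut_nonneg (R : ℝ) (x : E d) : 0 ≤ cut R x := le_max_left _ _

theorem cut_le_one (R : ℝ) (x : E d) : cut R x ≤ 1 := max_le zero_le_one (min_le_left _ _)

theorem abs_cut_le_one (R : ℝ) (x : E d) : |cut R x| ≤ 1 := by
  rw [abs_of_nonneg (cut_nonneg R x)]; exact cut_le_one R x

theorem cut_eq_one {R : ℝ} {x : E d} (h : ‖x‖ ≤ R) : cut R x = 1 := by
  unfold cut
  rw [min_eq_left (by linarith)]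
  simp

theorem cut_eq_zero {R : ℝ} {x : E d} (h : R + 1 ≤ ‖x‖) : cut R x = 0 :=
  max_eq_left ((min_le_right _ _).trans (by linarith))

theorem cut_mono {R R' : ℝ} (h : R ≤ R') (x : E d) : cut R x ≤ cut R' x :=
  max_le_max_left _ (min_le_min_left _ (by linarith))

theorem hasCompactSupport_cut (R : ℝ) : HasCompactSupport (cut R : E d → ℝ) :=
  HasCompactSupport.intro (isCompact_closedBall (0 : E d) (R + 1)) fun x hx => by
    apply cut_eq_zero
    simp only [Metric.mem_closedBall, dist_zero_right, not_le] at hx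
    exact hx.le

theorem tendsto_cut (x : E d) : Tendsto (fun R : ℝ => cut R x) atTop (𝓝 1) :=
  tendsto_const_nhds.congr' <| by
    filter_upwards [eventually_ge_atTop ‖x‖] with R hR
    exact (cut_eq_one hR).symm

theorem integrable_cut (R : ℝ) (μ : Measure (E d)) [IsFiniteMeasure μ] :
    Integrable (cut R) μ :=
  (continuous_cut R).integrable_of_hasCompactSupport (hasCompactSupport_cut R)

theorem tendsto_integral_cut (μ : Measure (E d)) [IsFiniteMeasure μ] :
    Tendsto (fun R : ℝ => ∫ x, cut R x ∂μ) atTop (𝓝 (μ.real Set.univ)) := by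
  have h := tendsto_integral_filter_of_dominated_convergence (μ := μ) (l := atTop)
    (F := fun R : ℝ => (cut R : E d → ℝ)) (f := fun _ => (1 : ℝ)) (fun _ => 1)
    (Eventually.of_forall fun R => (continuous_cut R).aestronglyMeasurable)
    (Eventually.of_forall fun R => Eventually.of_forall fun x => abs_cut_le_one R x)
    (integrable_const _) (Eventually.of_forall tendsto_cut)
  simpa using h

theorem integral_cut_le (R : ℝ) (μ : Measure (E d)) [IsFiniteMeasure μ] :
    ∫ x, cut R x ∂μ ≤ μ.real Set.univ := by
  have := integral_mono (integrable_cut R μ) (integrable_const (1 : ℝ)) (cut_le_one R)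
  simpa using this

theorem measureReal_univ_pos {α : FiniteMeasure (E d)} (h : α ≠ 0) :
    0 < (α : Measure (E d)).real Set.univ := by
  refine lt_of_le_of_ne measureReal_nonneg (Ne.symm ?_)
  rw [Ne, measureReal_eq_zero_iff (measure_ne_top _ _), Measure.measure_univ_eq_zero]
  exact fun h' => h (Subtype.ext h')

/-! ### Vague limits -/

/-- Vague convergence of the measures `m i` to `α` along `l`: convergence of the integrals of
continuous functions of compact support. -/
def VagueLim (l : Filter ι) (m : ι → Measure (E d)) (α : Measure (E d)) : Prop :=
  ∀ g : E d → ℝ, Continuous g → HasCompactSupport g →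
    Tendsto (fun i => ∫ x, g x ∂m i) l (𝓝 (∫ x, g x ∂α))

/-- Sub-probability measures are vaguely compact: along an ultrafilter the integrals of compactly
supported functions converge, and the limit is a positive functional. -/
theorem exists_vagueLim (𝒰 : Ultrafilter ι) (m : ι → Measure (E d))
    [∀ i, IsProbabilityMeasure (m i)] :
    ∃ α : FiniteMeasure (E d), VagueLim 𝒰 m (α : Measure (E d)) := by
  have L (g : CompactlySupportedContinuousMap (E d) ℝ) :
      ∃ x, Tendsto (fun i ↦ ∫ x, g x ∂m i) 𝒰 (𝓝 x) := by
    obtain ⟨x, -, hx⟩ : ∃ x ∈ Set.Icc (-‖g.toBoundedContinuousFunction‖)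
        (‖g.toBoundedContinuousFunction‖),
        ((𝒰.map (fun i ↦ ∫ x, g x ∂m i) : Ultrafilter ℝ) : Filter ℝ) ≤ 𝓝 x := by
      refine isCompact_Icc.ultrafilter_le_nhds' _
        (Ultrafilter.mem_map.2 (Filter.univ_mem' fun i => ?_))
      have := g.toBoundedContinuousFunction.norm_integral_le_norm (m i)
      rw [Real.norm_eq_abs, abs_le] at this
      simpa using this
    exact ⟨x, hx⟩
  have hint (g : CompactlySupportedContinuousMap (E d) ℝ) (i : ι) :
      Integrable (fun x => g x) (m i) :=
    g.continuous.integrable_of_hasCompactSupport g.hasCompactSupport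
  choose Λ hΛ using L
  let Λ' : (CompactlySupportedContinuousMap (E d) ℝ) →ₚ[ℝ] ℝ :=
  { toFun := Λ
    map_add' g g' := by
      refine tendsto_nhds_unique (hΛ (g + g')) (((hΛ g).add (hΛ g')).congr fun i => ?_)
      exact (integral_add (hint g i) (hint g' i)).symm
    map_smul' c g := by
      refine tendsto_nhds_unique (hΛ (c • g)) (((hΛ g).const_smul c).congr fun i => ?_)
      exact (integral_smul c _).symm
    monotone' g g' hgg' :=
      le_of_tendsto_of_tendsto' (hΛ g) (hΛ g') fun i ↦
        integral_mono (hint g i) (hint g' i) hgg' }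
  let α := RealRMK.rieszMeasure Λ'
  have hball (n : ℕ) : α (Metric.closedBall 0 n) ≤ 1 := by
    let o : CompactlySupportedContinuousMap (E d) ℝ :=
      ⟨⟨cut n, continuous_cut n⟩, hasCompactSupport_cut n⟩
    have : α (Metric.closedBall 0 n) ≤ ENNReal.ofReal (Λ' o) :=
      RealRMK.rieszMeasure_le_of_eq_one Λ' (fun x ↦ cut_nonneg _ x)
        (isCompact_closedBall (0 : E d) n) (fun x hx ↦ cut_eq_one (by simpa using hx))
    refine this.trans ?_
    rw [← ENNReal.ofReal_one]
    refine ENNReal.ofReal_le_ofReal (le_of_tendsto' (hΛ o) fun i => ?_)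
    exact (integral_cut_le (n : ℝ) (m i)).trans_eq (by simp)
  have hfin : α Set.univ ≤ 1 := by
    rw [← Metric.iUnion_closedBall_nat (0 : E d),
      Monotone.measure_iUnion fun a b hab => Metric.closedBall_subset_closedBall (by simpa)]
    exact iSup_le hball
  refine ⟨⟨α, ⟨hfin.trans_lt (by simp)⟩⟩, fun g hg hg' => ?_⟩
  have := RealRMK.integral_rieszMeasure Λ' ⟨⟨g, hg⟩, hg'⟩
  change Tendsto _ _ (𝓝 (∫ x, g x ∂α))
  change ∫ x, g x ∂α = _ at this
  rw [this]
  exact hΛ ⟨⟨g, hg⟩, hg'⟩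

/-- A vague limit of probability measures that keeps the whole mass is a weak limit. -/
theorem VagueLim.tendsto_probabilityMeasure {l : Filter ι} {m : ι → ProbabilityMeasure (E d)}
    {α : ProbabilityMeasure (E d)} (h : VagueLim l (fun i => (m i : Measure (E d))) α) :
    Tendsto m l (𝓝 α) := by
  rw [ProbabilityMeasure.tendsto_iff_forall_integral_tendsto]
  intro g
  have key : ∀ (β : ProbabilityMeasure (E d)) (R : ℝ),
      |(∫ x, g x ∂(β : Measure (E d))) - ∫ x, cut R x * g x ∂(β : Measure (E d))| ≤
        ‖g‖ * (1 - ∫ x, cut R x ∂(β : Measure (E d))) := by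
    intro β R
    have hi : Integrable (fun x => cut R x * g x) (β : Measure (E d)) :=
      (((continuous_cut R).mul g.continuous).integrable_of_hasCompactSupport
        ((hasCompactSupport_cut R).mul_right))
    rw [← integral_sub (g.integrable _) hi]
    have : ‖g‖ * (1 - ∫ x, cut R x ∂(β : Measure (E d))) =
        ∫ x, ‖g‖ * (1 - cut R x) ∂(β : Measure (E d)) := by
      rw [integral_const_mul, integral_sub (integrable_const _) (integrable_cut R _)]
      simp
    rw [this]
    refine norm_integral_le_of_norm_le (μ := (β : Measure (E d)))
      (f := fun x => g x - cut R x * g x)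
      (((integrable_const _).sub (integrable_cut R _)).const_mul _)
      (Eventually.of_forall fun x => ?_)
    rw [show g x - cut R x * g x = g x * (1 - cut R x) by ring, norm_mul,
      Real.norm_of_nonneg (sub_nonneg.2 (cut_le_one R x))]
    exact mul_le_mul_of_nonneg_right (g.norm_coe_le_norm x) (sub_nonneg.2 (cut_le_one R x))
  rw [Metric.tendsto_nhds]
  intro ε hε
  have hlim := (tendsto_integral_cut (α : Measure (E d))).const_sub 1 |>.const_mul ‖g‖
  have h1 : (α : Measure (E d)).real Set.univ = 1 := by simp
  rw [h1, sub_self, mul_zero] at hlim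
  obtain ⟨R, hR⟩ := (hlim.eventually_lt_const (show (0 : ℝ) < ε / 3 by positivity)).exists
  have hc1 := ((h _ (continuous_cut R) (hasCompactSupport_cut R)).const_sub 1).const_mul ‖g‖
  have hc2 := h _ ((continuous_cut R).mul g.continuous) ((hasCompactSupport_cut R).mul_right)
  filter_upwards [hc1.eventually_lt_const hR,
    (Metric.tendsto_nhds.1 hc2) (ε / 3) (by positivity)] with i h1 h2
  have k1 := (key (m i) R).trans_lt h1
  have k2 := (key α R).trans_lt hR
  rw [Real.dist_eq] at h2 ⊢
  simp only [Pi.mul_apply] at h2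
  rw [abs_lt] at *
  constructor <;> linarith [k1.1, k1.2, k2.1, k2.2, h2.1, h2.2]

/-! ### Vague limits of products -/

/-- The product cutoff on configurations of pairs. -/
noncomputable def cutPairs {k : ℕ} (R : ℝ) (z : Fin k → E d × E d) : ℝ :=
  ∏ l, cut R (z l).1 * cut R (z l).2

theorem continuous_cutPairs {k : ℕ} (R : ℝ) :
    Continuous (cutPairs R : (Fin k → E d × E d) → ℝ) := by
  have := continuous_cut (d := d) R
  unfold cutPairs
  fun_prop

theorem cutPairs_nonneg {k : ℕ} (R : ℝ) (z : Fin k → E d × E d) : 0 ≤ cutPairs R z :=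
  Finset.prod_nonneg fun _ _ => mul_nonneg (cut_nonneg _ _) (cut_nonneg _ _)

theorem cutPairs_le_one {k : ℕ} (R : ℝ) (z : Fin k → E d × E d) : cutPairs R z ≤ 1 :=
  Finset.prod_le_one (fun _ _ => mul_nonneg (cut_nonneg _ _) (cut_nonneg _ _))
    fun _ _ => mul_le_one₀ (cut_le_one _ _) (cut_nonneg _ _) (cut_le_one _ _)

theorem cutPairs_eq_one {k : ℕ} {R : ℝ} {z : Fin k → E d × E d} (h : ‖z‖ ≤ R) :
    cutPairs R z = 1 :=
  Finset.prod_eq_one fun l _ => by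
    have hl := (norm_le_pi_norm z l).trans h
    rw [cut_eq_one ((norm_fst_le _).trans hl), cut_eq_one ((norm_snd_le _).trans hl), one_mul]

theorem norm_le_of_cutPairs_ne_zero {k : ℕ} {R : ℝ} (hR : 0 ≤ R) {z : Fin k → E d × E d}
    (h : cutPairs R z ≠ 0) : ‖z‖ ≤ R + 1 := by
  rw [pi_norm_le_iff_of_nonneg (by linarith)]
  intro l
  by_contra! hl
  refine h (Finset.prod_eq_zero (Finset.mem_univ l) ?_)
  rw [Prod.norm_def, lt_max_iff] at hl
  rcases hl with hl | hl
  · rw [cut_eq_zero hl.le, zero_mul]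
  · rw [cut_eq_zero hl.le, mul_zero]

theorem integral_pi_prod_mul {k : ℕ} (α β : Measure (E d)) [IsFiniteMeasure α] [IsFiniteMeasure β]
    (u v : Fin k → E d → ℝ) :
    ∫ z : Fin k → E d × E d, ∏ l, u l (z l).1 * v l (z l).2 ∂(Measure.pi fun _ => α.prod β) =
      ∏ l, (∫ x, u l x ∂α) * ∫ y, v l y ∂β := by
  rw [integral_fin_nat_prod_eq_prod (f := fun l (p : E d × E d) => u l p.1 * v l p.2)]
  exact Finset.prod_congr rfl fun l _ => integral_prod_mul _ _

/-- The functions on configurations that are products of one-point functions. -/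
def productFunctions (d k : ℕ) : Submonoid C(Fin k → E d × E d, ℝ) where
  carrier := {P | ∃ u v : Fin k → C(E d, ℝ), ∀ z, P z = ∏ l, u l (z l).1 * v l (z l).2}
  one_mem' := ⟨1, 1, fun z => by simp⟩
  mul_mem' := by
    rintro P Q ⟨u, v, h⟩ ⟨u', v', h'⟩
    refine ⟨u * u', v * v', fun z => ?_⟩
    rw [ContinuousMap.mul_apply, h, h', ← Finset.prod_mul_distrib]
    exact Finset.prod_congr rfl fun l _ => by simp; ring

theorem separatesPoints_productFunctions (d k : ℕ) :
    (Algebra.adjoin ℝ (productFunctions d k : Set C(Fin k → E d × E d, ℝ))).SeparatesPoints := by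
  intro z w hzw
  obtain ⟨l, hl⟩ := Function.ne_iff.1 hzw
  by_cases h1 : (z l).1 = (w l).1
  · have h2 : (z l).2 ≠ (w l).2 := fun h2 => hl (Prod.ext h1 h2)
    let g : C(E d, ℝ) := ⟨fun x => dist x (w l).2, by fun_prop⟩
    refine ⟨_, ⟨⟨fun z => g (z l).2, by fun_prop⟩, Algebra.subset_adjoin
      ⟨1, Pi.mulSingle l g, fun z => ?_⟩, rfl⟩, ?_⟩
    · change g (z l).2 = _
      rw [Finset.prod_eq_single l (fun b _ hb => by simp [hb]) (by simp)]
      simp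
    · simpa [g] using h2
  · let g : C(E d, ℝ) := ⟨fun x => dist x (w l).1, by fun_prop⟩
    refine ⟨_, ⟨⟨fun z => g (z l).1, by fun_prop⟩, Algebra.subset_adjoin
      ⟨Pi.mulSingle l g, 1, fun z => ?_⟩, rfl⟩, ?_⟩
    · change g (z l).1 = _
      rw [Finset.prod_eq_single l (fun b _ hb => by simp [hb]) (by simp)]
      simp
    · simpa [g] using h1

theorem integrable_cutPairs_mul {k : ℕ} {R : ℝ} (hR : 0 ≤ R) (P : C(Fin k → E d × E d, ℝ))
    (M : Measure (Fin k → E d × E d)) [IsFiniteMeasure M] :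
    Integrable (fun z => cutPairs R z * P z) M := by
  refine ((continuous_cutPairs R).mul P.continuous).integrable_of_hasCompactSupport
    (HasCompactSupport.intro (isCompact_closedBall 0 (R + 1)) fun z hz => ?_)
  have : cutPairs R z = 0 := by
    by_contra h
    exact hz (by simpa using norm_le_of_cutPairs_ne_zero hR h)
  simp [this]

/-- Vague limits of both factors give vague limits of the powers of the product measure, tested
against continuous functions vanishing at infinity: by the Stone–Weierstrass theorem these are
approximated by sums of products of one-point functions. -/
theorem VagueLim.tendsto_integral_pi {l : Filter ι} {m n : ι → Measure (E d)}
    [∀ i, IsProbabilityMeasure (m i)] [∀ i, IsProbabilityMeasure (n i)]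
    {α β : Measure (E d)} [IsFiniteMeasure α] [IsFiniteMeasure β]
    (hm : VagueLim l m α) (hn : VagueLim l n β) {k : ℕ} {F : (Fin k → E d × E d) → ℝ}
    (hF : Continuous F) (hF0 : Tendsto F (cocompact _) (𝓝 0)) :
    Tendsto (fun i => ∫ z, F z ∂(Measure.pi fun _ => (m i).prod (n i))) l
      (𝓝 (∫ z, F z ∂(Measure.pi fun _ => α.prod β))) := by
  have hpoly : ∀ R : ℝ, 0 ≤ R →
      ∀ P ∈ Algebra.adjoin ℝ (productFunctions d k : Set C(Fin k → E d × E d, ℝ)),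
      Tendsto (fun i => ∫ z, cutPairs R z * P z ∂(Measure.pi fun _ => (m i).prod (n i))) l
        (𝓝 (∫ z, cutPairs R z * P z ∂(Measure.pi fun _ => α.prod β))) := by
    intro R hR P hP
    rw [← Subalgebra.mem_toSubmodule, Algebra.adjoin_eq_span, Submonoid.closure_eq] at hP
    induction hP using Submodule.span_induction with
    | mem P hP =>
      obtain ⟨u, v, h⟩ := hP
      have hrw : ∀ z, cutPairs R z * P z =
          ∏ l, (cut R (z l).1 * u l (z l).1) * (cut R (z l).2 * v l (z l).2) := by
        intro z
        rw [h, cutPairs, ← Finset.prod_mul_distrib]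
        exact Finset.prod_congr rfl fun l _ => by ring
      simp only [hrw]
      have hrw2 : ∀ (α β : Measure (E d)) [IsFiniteMeasure α] [IsFiniteMeasure β],
          ∫ z : Fin k → E d × E d, ∏ l, (cut R (z l).1 * u l (z l).1) *
            (cut R (z l).2 * v l (z l).2) ∂(Measure.pi fun _ => α.prod β) =
          ∏ l, (∫ x, cut R x * u l x ∂α) * ∫ y, cut R y * v l y ∂β := fun α β _ _ =>
        integral_pi_prod_mul α β (fun l x => cut R x * u l x) (fun l x => cut R x * v l x)
      simp only [hrw2]
      exact tendsto_finsetProd _ fun l _ => Tendsto.mul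
        (hm _ ((continuous_cut R).mul (u l).continuous) (hasCompactSupport_cut R).mul_right)
        (hn _ ((continuous_cut R).mul (v l).continuous) (hasCompactSupport_cut R).mul_right)
    | zero => simpa using tendsto_const_nhds
    | add P Q _ _ hP hQ =>
      simp only [ContinuousMap.add_apply, mul_add]
      rw [integral_add (integrable_cutPairs_mul hR P _) (integrable_cutPairs_mul hR Q _)]
      refine (hP.add hQ).congr fun i => ?_
      rw [integral_add (integrable_cutPairs_mul hR P _) (integrable_cutPairs_mul hR Q _)]
    | smul c P _ hP =>
      simp only [ContinuousMap.smul_apply, smul_eq_mul, mul_left_comm _ c, integral_const_mul]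
      exact hP.const_mul c
  have hFi : ∀ (M : Measure (Fin k → E d × E d)) [IsFiniteMeasure M], Integrable F M := by
    intro M _
    let F' : ZeroAtInftyContinuousMap (Fin k → E d × E d) ℝ := ⟨⟨F, hF⟩, hF0⟩
    exact F'.toBCF.integrable M
  -- `F` is approximated within `δ` by a cut off element of the algebra
  have happ : ∀ δ > 0, ∃ R : ℝ, 0 ≤ R ∧
      ∃ P ∈ Algebra.adjoin ℝ (productFunctions d k : Set C(Fin k → E d × E d, ℝ)),
        ∀ z, |F z - cutPairs R z * P z| ≤ δ := by
    intro δ hδ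
    rw [← Metric.cobounded_eq_cocompact] at hF0
    obtain ⟨R, hR⟩ := (Metric.hasBasis_cobounded_compl_closedBall
      (0 : Fin k → E d × E d)).eventually_iff.1
        ((Metric.tendsto_nhds.1 hF0) (δ / 2) (by positivity))
    have hR0 : ∀ z : Fin k → E d × E d, max R 0 < ‖z‖ → |F z| < δ / 2 := by
      intro z hz
      simpa using hR.2 (x := z) (by simpa using (le_max_left R 0).trans_lt hz)
    obtain ⟨P, hP, hPF⟩ :=
      ContinuousMap.exists_mem_subalgebra_near_continuous_of_isCompact_of_separatesPoints
        (separatesPoints_productFunctions d k) ⟨F, hF⟩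
        (isCompact_closedBall (0 : Fin k → E d × E d) (max R 0 + 1)) (half_pos hδ)
    refine ⟨max R 0, le_max_right _ _, P, hP, fun z => ?_⟩
    have h1 : |F z - cutPairs (max R 0) z * F z| ≤ δ / 2 := by
      by_cases hz : ‖z‖ ≤ max R 0
      · rw [cutPairs_eq_one hz]; simp; positivity
      · rw [show F z - cutPairs (max R 0) z * F z = (1 - cutPairs (max R 0) z) * F z by ring,
          abs_mul, abs_of_nonneg (sub_nonneg.2 (cutPairs_le_one _ z))]
        have := hR0 z (not_le.1 hz)
        have h3 := cutPairs_nonneg (max R 0) z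
        nlinarith [abs_nonneg (F z)]
    have h2 : |cutPairs (max R 0) z * F z - cutPairs (max R 0) z * P z| ≤ δ / 2 := by
      by_cases hz : cutPairs (max R 0) z = 0
      · rw [hz]; simp; positivity
      · have hb := norm_le_of_cutPairs_ne_zero (le_max_right _ _) hz
        have := (hPF z (by simpa using hb)).le
        rw [← mul_sub, abs_mul, abs_of_nonneg (cutPairs_nonneg _ _), abs_sub_comm]
        exact (mul_le_of_le_one_left (abs_nonneg _) (cutPairs_le_one _ _)).trans this
    calc |F z - cutPairs (max R 0) z * P z|
        ≤ |F z - cutPairs (max R 0) z * F z|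
          + |cutPairs (max R 0) z * F z - cutPairs (max R 0) z * P z| := abs_sub_le _ _ _
      _ ≤ δ := by linarith
  have hdiff : ∀ (M : Measure (Fin k → E d × E d)) [IsFiniteMeasure M] (δ R : ℝ)
      (P : C(Fin k → E d × E d, ℝ)), 0 ≤ R → (∀ z, |F z - cutPairs R z * P z| ≤ δ) →
      |(∫ z, F z ∂M) - ∫ z, cutPairs R z * P z ∂M| ≤ δ * M.real Set.univ := by
    intro M _ δ R P hR h
    rw [← integral_sub (hFi M) (integrable_cutPairs_mul hR P M)]
    exact norm_integral_le_of_norm_le_const (μ := M)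
      (f := fun z => F z - cutPairs R z * P z) (Eventually.of_forall h)
  rw [Metric.tendsto_nhds]
  intro ε hε
  set C : ℝ := (Measure.pi fun _ : Fin k => α.prod β).real Set.univ + 1 with hC
  have hCpos : 0 < C := by positivity
  have hC1 : (1 : ℝ) ≤ C := by
    rw [hC]; exact le_add_of_nonneg_left measureReal_nonneg
  obtain ⟨R, hR, P, hP, hFP⟩ := happ (ε / 3 / C) (by positivity)
  filter_upwards [Metric.tendsto_nhds.1 (hpoly R hR P hP) (ε / 3) (by positivity)] with i hi
  have h1 := hdiff (Measure.pi fun _ => (m i).prod (n i)) _ R P hR hFP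
  have h2 := hdiff (Measure.pi fun _ => α.prod β) _ R P hR hFP
  have h3 : ε / 3 / C * (Measure.pi fun _ : Fin k => (m i).prod (n i)).real Set.univ ≤ ε / 3 := by
    rw [probReal_univ, mul_one]
    exact div_le_self (by positivity) hC1
  have h4 : ε / 3 / C * (Measure.pi fun _ : Fin k => α.prod β).real Set.univ < ε / 3 := by
    rw [div_mul_eq_mul_div, div_lt_iff₀ hCpos]
    exact mul_lt_mul_of_pos_left (by rw [hC]; linarith) (by positivity)
  rw [Real.dist_eq] at hi ⊢
  have h1' := h1.trans h3
  have h2' := h2.trans_lt h4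
  rw [abs_le] at h1'
  rw [abs_lt] at *
  constructor <;> linarith [h1'.1, h1'.2, h2'.1, h2'.2, hi.1, hi.2]

/-! ### Test functions -/

/-- The index of the first pair of a configuration. -/
def firstIndex (k : ℕ+) : Fin (k : ℕ) := ⟨0, k.pos⟩

theorem norm_sub_le_spread {k : ℕ} (z : Fin k → E d × E d) (l : Fin k) :
    ‖(z l).2 - (z l).1‖ ≤ spread z := by
  rw [← dist_eq_norm]
  exact Metric.dist_le_diam_of_mem ((Set.finite_range _).union (Set.finite_range _)).isBounded
    (Or.inr ⟨l, rfl⟩) (Or.inl ⟨l, rfl⟩)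

theorem norm_le_add_spread {k : ℕ} (z : Fin k → E d × E d) (o : Fin k) :
    ‖z‖ ≤ ‖(z o).1‖ + spread z := by
  have hb := ((Set.finite_range fun i => (z i).1).union
    (Set.finite_range fun i => (z i).2)).isBounded
  have h : ∀ y ∈ Set.range (fun i => (z i).1) ∪ Set.range (fun i => (z i).2),
      ‖y‖ ≤ ‖(z o).1‖ + spread z := by
    intro y hy
    have := Metric.dist_le_diam_of_mem hb hy (Or.inl ⟨o, rfl⟩)
    rw [dist_eq_norm] at this
    calc ‖y‖ = ‖(z o).1 + (y - (z o).1)‖ := by congr 1; abel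
      _ ≤ _ := (norm_add_le _ _).trans (add_le_add_right this _)
  have h0 : 0 ≤ ‖(z o).1‖ + spread z := add_nonneg (norm_nonneg _) Metric.diam_nonneg
  rw [pi_norm_le_iff_of_nonneg h0]
  exact fun l => max_le (h _ (Or.inl ⟨l, rfl⟩)) (h _ (Or.inr ⟨l, rfl⟩))

theorem exists_spread_bound (f : TestFunction d) {ε : ℝ} (hε : 0 < ε) :
    ∃ S : ℝ, 0 < S ∧ ∀ z, S < spread z → |f.2.1 z| < ε := by
  have h := (Metric.tendsto_nhds.1 f.2.2.2) ε hε
  rw [eventually_comap, eventually_atTop] at h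
  obtain ⟨S, hS⟩ := h
  exact ⟨max S 1, by positivity, fun z hz => by
    simpa using hS (spread z) ((le_max_left _ _).trans hz.le) z rfl⟩

theorem tendsto_cut_mul_cocompact (f : TestFunction d) (R : ℝ) :
    Tendsto (fun z => cut R (z (firstIndex f.1)).1 * f.2.1 z) (cocompact _) (𝓝 0) := by
  rw [← Metric.cobounded_eq_cocompact, Metric.tendsto_nhds]
  intro ε hε
  obtain ⟨S, -, hS⟩ := exists_spread_bound f hε
  rw [Metric.hasBasis_cobounded_compl_closedBall
    (0 : Fin (f.1 : ℕ) → E d × E d) |>.eventually_iff]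
  refine ⟨R + 1 + S, trivial, fun z hz => ?_⟩
  simp only [Set.mem_compl_iff, Metric.mem_closedBall, dist_zero_right, not_le] at hz
  rw [dist_zero_right, norm_mul]
  by_cases hx : R + 1 ≤ ‖(z (firstIndex f.1)).1‖
  · rw [cut_eq_zero hx]
    simpa using hε
  · have h1 := norm_le_add_spread z (firstIndex f.1)
    exact (mul_le_of_le_one_left (norm_nonneg _) (abs_cut_le_one _ _)).trans_lt
      (hS z (by linarith))

theorem pi_translate {k : ℕ} (α β : Measure (E d)) [IsFiniteMeasure α] [IsFiniteMeasure β]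
    (x : E d) :
    (Measure.pi fun _ : Fin k => (translate α x).prod (translate β x)) =
      (Measure.pi fun _ : Fin k => α.prod β).map (diagShift x) := by
  have hm : Measurable (fun y : E d => y + x) := measurable_add_const x
  have hm2 : Measurable (Prod.map (fun y : E d => y + x) (fun y : E d => y + x)) := hm.prodMap hm
  have : (translate α x).prod (translate β x) =
      (α.prod β).map (Prod.map (fun y => y + x) (fun y => y + x)) := Measure.map_prod_map _ _ hm hm
  rw [this, ← Measure.pi_map_pi (fun _ => hm2.aemeasurable)]
  rfl

theorem measurable_diagShift {k : ℕ} (x : E d) : Measurable (diagShift (k := k) x) := by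
  unfold diagShift
  fun_prop

/-- Recentring the measures moves a cutoff of the first point to the origin. -/
theorem integral_cut_sub_mul (f : TestFunction d) (α β : Measure (E d)) [IsFiniteMeasure α]
    [IsFiniteMeasure β] (R : ℝ) (a : E d) :
    ∫ z, cut R ((z (firstIndex f.1)).1 - a) * f.2.1 z ∂(Measure.pi fun _ => α.prod β) =
      ∫ z, cut R (z (firstIndex f.1)).1 * f.2.1 z
        ∂(Measure.pi fun _ => (translate α (-a)).prod (translate β (-a))) := by
  have hc := continuous_cut (d := d) R
  rw [pi_translate, integral_map (measurable_diagShift _).aemeasurable]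
  · refine integral_congr_ae (Eventually.of_forall fun z => ?_)
    simp only [f.2.2.1, diagShift, sub_eq_add_neg]
  · exact ((hc.comp (by fun_prop)).mul f.2.1.continuous).aestronglyMeasurable

theorem integrable_cut_sub_mul (f : TestFunction d) (M : Measure (Fin (f.1 : ℕ) → E d × E d))
    [IsFiniteMeasure M] (R : ℝ) (a : E d) :
    Integrable (fun z => cut R ((z (firstIndex f.1)).1 - a) * f.2.1 z) M := by
  have hc := continuous_cut (d := d) R
  exact (f.2.1.integrable M).bdd_mul (c := 1)
    ((hc.comp (by fun_prop : Continuous fun z : Fin (f.1 : ℕ) → E d × E d =>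
      (z (firstIndex f.1)).1 - a)).aestronglyMeasurable)
    (Eventually.of_forall fun z => abs_cut_le_one _ _)

theorem tendsto_integral_cut_mul (f : TestFunction d) (α β : Measure (E d)) [IsFiniteMeasure α]
    [IsFiniteMeasure β] :
    Tendsto (fun R : ℝ => ∫ z, cut R (z (firstIndex f.1)).1 * f.2.1 z
      ∂(Measure.pi fun _ => α.prod β)) atTop (𝓝 (pairIntegral f α β)) := by
  refine tendsto_integral_filter_of_dominated_convergence (fun _ => ‖f.2.1‖)
    (Eventually.of_forall fun R => ?_)
    (Eventually.of_forall fun R => Eventually.of_forall fun z => ?_)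
    (integrable_const _) (Eventually.of_forall fun z => ?_)
  · simpa using (integrable_cut_sub_mul f (Measure.pi fun _ => α.prod β) R 0).aestronglyMeasurable
  · rw [norm_mul]
    exact (mul_le_of_le_one_left (norm_nonneg _) (abs_cut_le_one _ _)).trans
      (f.2.1.norm_coe_le_norm z)
  · simpa using (tendsto_cut (z (firstIndex f.1)).1).mul_const (f.2.1 z)

theorem abs_integral_pi_le {k : ℕ} (hk : 0 < k) (g : (Fin k → E d × E d) →ᵇ ℝ)
    (α β : Measure (E d)) [IsFiniteMeasure α] [IsFiniteMeasure β] (hα : α.real Set.univ ≤ 1)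
    (hβ : β.real Set.univ ≤ 1) :
    |∫ z, g z ∂(Measure.pi fun _ => α.prod β)| ≤ ‖g‖ * α.real Set.univ := by
  refine (g.norm_integral_le_mul_norm (Measure.pi fun _ => α.prod β)).trans ?_
  rw [mul_comm]
  refine mul_le_mul_of_nonneg_left ?_ (norm_nonneg _)
  have hpi : (Measure.pi fun _ : Fin k => α.prod β).real Set.univ =
      (α.real Set.univ * β.real Set.univ) ^ k := by
    rw [measureReal_def, Measure.pi_univ]
    simp [measureReal_def, ← Set.univ_prod_univ]
  rw [hpi]
  have h0 : 0 ≤ α.real Set.univ * β.real Set.univ := by positivity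
  have h1 : α.real Set.univ * β.real Set.univ ≤ 1 := mul_le_one₀ hα measureReal_nonneg hβ
  calc _ ≤ (α.real Set.univ * β.real Set.univ) ^ 1 := pow_le_pow_of_le_one h0 h1 hk
    _ ≤ _ := by rw [pow_one]; exact mul_le_of_le_one_right measureReal_nonneg hβ

theorem abs_pairIntegral_le (f : TestFunction d) (α β : Measure (E d)) [IsFiniteMeasure α]
    [IsFiniteMeasure β] (hα : α.real Set.univ ≤ 1) (hβ : β.real Set.univ ≤ 1) :
    |pairIntegral f α β| ≤ ‖f.2.1‖ * α.real Set.univ :=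
  abs_integral_pi_le f.1.pos f.2.1 α β hα hβ

/-! ### Pairs of nearby points -/

theorem volume_closedBall_eq (x : E d) (r : ℝ) :
    volume (Metric.closedBall x r) = volume (Metric.closedBall (0 : E d) r) :=
  Measure.addHaar_closedBall_center _ _ _

theorem lintegral_measure_closedBall (μ : Measure (E d)) [IsProbabilityMeasure μ] (r : ℝ) :
    ∫⁻ w, μ (Metric.closedBall w r) = volume (Metric.closedBall (0 : E d) r) := by
  have hW : MeasurableSet {q : E d × E d | dist q.1 q.2 ≤ r} :=
    (isClosed_le (by fun_prop) continuous_const).measurableSet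
  have h1 := Measure.prod_apply (μ := μ) (ν := volume) hW
  rw [Measure.prod_apply_symm hW] at h1
  have h2 : ∀ x : E d, Prod.mk x ⁻¹' {q : E d × E d | dist q.1 q.2 ≤ r} =
      Metric.closedBall x r := fun x => by ext; simp [dist_comm]
  have h3 : ∀ y : E d, (fun x => (x, y)) ⁻¹' {q : E d × E d | dist q.1 q.2 ≤ r} =
      Metric.closedBall y r := fun x => by ext; simp
  simp only [h2, h3, volume_closedBall_eq] at h1
  simpa using h1

/-- If around every point near `A` one of two probability measures gives little mass to a ball,
then few pairs of nearby points start in `A`. Averaging over the centre `w` of a ball containing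
both points bounds the mass of these pairs by the integral over `w` of the product of the masses of
the balls around `w`, which is at most the smaller mass times the sum of both. -/
theorem prod_near_le (μ ν : Measure (E d)) [IsProbabilityMeasure μ] [IsProbabilityMeasure ν]
    {A : Set (E d)} (hA : MeasurableSet A) (S : ℝ) (δ : ENNReal)
    (h : ∀ w, (∃ x ∈ A, dist x w ≤ S) →
      min (μ (Metric.closedBall w (2 * S))) (ν (Metric.closedBall w (2 * S))) ≤ δ) :
    (μ.prod ν) {p | p.1 ∈ A ∧ ‖p.2 - p.1‖ ≤ S} * volume (Metric.closedBall (0 : E d) S) ≤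
      δ * (2 * volume (Metric.closedBall (0 : E d) (2 * S))) := by
  set T : Set (E d × E d) := {p | p.1 ∈ A ∧ ‖p.2 - p.1‖ ≤ S} with hT
  set W : Set ((E d × E d) × E d) := {q | q.1 ∈ T ∧ dist q.1.1 q.2 ≤ S} with hW
  have hTm : MeasurableSet T :=
    (measurable_fst hA).inter
      (isClosed_le (f := fun p : E d × E d => ‖p.2 - p.1‖) (by fun_prop)
        continuous_const).measurableSet
  have hWm : MeasurableSet W :=
    (measurable_fst hTm).inter
      (isClosed_le (f := fun q : (E d × E d) × E d => dist q.1.1 q.2) (by fun_prop)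
        continuous_const).measurableSet
  have h1 : (μ.prod ν) T * volume (Metric.closedBall (0 : E d) S) ≤
      ((μ.prod ν).prod volume) W := by
    rw [Measure.prod_apply hWm, mul_comm, ← lintegral_indicator_const hTm]
    refine lintegral_mono fun p => ?_
    by_cases hp : p ∈ T
    · rw [Set.indicator_of_mem hp, ← volume_closedBall_eq p.1]
      exact measure_mono fun w hw => ⟨hp, by simpa [dist_comm] using hw⟩
    · simp [Set.indicator_of_notMem hp]
  refine h1.trans ?_
  rw [Measure.prod_apply_symm hWm]
  have h2 : ∀ w : E d, (μ.prod ν) ((fun p => (p, w)) ⁻¹' W) ≤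
      δ * (μ (Metric.closedBall w (2 * S)) + ν (Metric.closedBall w (2 * S))) := by
    intro w
    by_cases hw : ∃ x ∈ A, dist x w ≤ S
    · have hsub : (fun p : E d × E d => (p, w)) ⁻¹' W ⊆
          Metric.closedBall w (2 * S) ×ˢ Metric.closedBall w (2 * S) := by
        rintro ⟨x, y⟩ ⟨⟨-, hxy⟩, hxw⟩
        simp only at hxy hxw
        rw [← dist_eq_norm] at hxy
        have h0 : 0 ≤ dist x w := dist_nonneg
        refine ⟨?_, ?_⟩ <;> simp only [Metric.mem_closedBall]
        · linarith
        · linarith [dist_triangle y x w]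
      refine (measure_mono hsub).trans ?_
      rw [Measure.prod_prod]
      rcases min_le_iff.1 (h w hw) with h' | h'
      · exact mul_le_mul' h' le_add_self
      · rw [mul_comm]
        exact mul_le_mul' h' le_self_add
    · have : (fun p : E d × E d => (p, w)) ⁻¹' W = ∅ :=
        Set.eq_empty_of_forall_notMem fun p hp => hw ⟨p.1, hp.1.1, hp.2⟩
      simp [this]
  refine (lintegral_mono h2).trans ?_
  have hmeas : ∀ (μ : Measure (E d)) [IsProbabilityMeasure μ],
      Measurable fun w : E d => μ (Metric.closedBall w (2 * S)) := by
    intro μ _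
    have hm : MeasurableSet {q : E d × E d | dist q.2 q.1 ≤ 2 * S} :=
      (isClosed_le (by fun_prop) continuous_const).measurableSet
    exact measurable_measure_prodMk_left (ν := μ) hm
  have hsum : Measurable fun w : E d =>
      μ (Metric.closedBall w (2 * S)) + ν (Metric.closedBall w (2 * S)) := (hmeas μ).add (hmeas ν)
  rw [lintegral_const_mul _ hsum, lintegral_add_left (hmeas μ),
    lintegral_measure_closedBall, lintegral_measure_closedBall,
    ← two_mul (volume (Metric.closedBall (0 : E d) (2 * S)))]

/-! ### Profiles -/

/-- A profile decomposition of the pairs `(μ i, ν i)` along an ultrafilter: centres `a j` at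
mutually diverging distances, vague limits `α j` and `β j` of the measures seen from these centres,
and no other place where mass of both measures accumulates. -/
structure IsProfile (𝒰 : Ultrafilter ι) (μ ν : ι → ProbabilityMeasure (E d))
    (α β : κ → FiniteMeasure (E d)) (a : κ → ι → E d) : Prop where
  vague_left : ∀ j, VagueLim 𝒰 (fun i => translate (μ i) (-a j i)) (α j)
  vague_right : ∀ j, VagueLim 𝒰 (fun i => translate (ν i) (-a j i)) (β j)
  separated : ∀ j j', j ≠ j' → Tendsto (fun i => ‖a j i - a j' i‖) 𝒰 atTop
  maximal : ∀ (b : ι → E d) (α' β' : FiniteMeasure (E d)),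
    VagueLim 𝒰 (fun i => translate (μ i) (-b i)) α' →
    VagueLim 𝒰 (fun i => translate (ν i) (-b i)) β' → α' ≠ 0 → β' ≠ 0 →
    ∃ j, ∃ T : ℝ, ∀ᶠ i in 𝒰, ‖b i - a j i‖ ≤ T

/-- Cutoffs around centres at diverging distances eventually have disjoint supports. -/
theorem eventually_sum_cut_le_one {l : Filter ι} {a : κ → ι → E d}
    (ha : ∀ j j', j ≠ j' → Tendsto (fun i => ‖a j i - a j' i‖) l atTop) (J : Finset κ) (R : ℝ) :
    ∀ᶠ i in l, ∀ x, ∑ j ∈ J, cut R (x - a j i) ≤ 1 := by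
  have h : ∀ᶠ i in l, ∀ j ∈ J, ∀ j' ∈ J, j ≠ j' → 2 * (R + 1) < ‖a j i - a j' i‖ := by
    rw [eventually_all_finset]
    intro j _
    rw [eventually_all_finset]
    intro j' _
    by_cases hj : j = j'
    · exact Eventually.of_forall fun _ h => absurd hj h
    · exact ((ha j j' hj).eventually_gt_atTop _).mono fun _ h _ => h
  filter_upwards [h] with i hi x
  by_cases hx : ∃ j ∈ J, cut R (x - a j i) ≠ 0
  · obtain ⟨j, hj, hjx⟩ := hx
    rw [Finset.sum_eq_single_of_mem j hj]
    · exact cut_le_one _ _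
    · intro j' hj' hne
      by_contra hj'x
      have h1 : ‖x - a j i‖ < R + 1 := not_le.1 fun h => hjx (cut_eq_zero h)
      have h2 : ‖x - a j' i‖ < R + 1 := not_le.1 fun h => hj'x (cut_eq_zero h)
      have h3 := hi j' hj' j hj hne
      have h4 := norm_sub_le (x - a j i) (x - a j' i)
      rw [sub_sub_sub_cancel_left] at h4
      linarith
  · push Not at hx
    rw [Finset.sum_eq_zero hx]
    exact zero_le_one

theorem integral_translate_neg (μ : Measure (E d)) (a : E d) {g : E d → ℝ} (hg : Continuous g) :
    ∫ y, g y ∂translate μ (-a) = ∫ y, g (y - a) ∂μ := by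
  simp only [integral_translate μ (-a) hg, sub_eq_add_neg]

theorem sum_mass_le_one {𝒰 : Ultrafilter ι} {μ : ι → ProbabilityMeasure (E d)}
    {α : κ → FiniteMeasure (E d)} {a : κ → ι → E d}
    (hα : ∀ j, VagueLim 𝒰 (fun i => translate (μ i) (-a j i)) (α j))
    (ha : ∀ j j', j ≠ j' → Tendsto (fun i => ‖a j i - a j' i‖) 𝒰 atTop) (J : Finset κ) :
    ∑ j ∈ J, (α j : Measure (E d)).real Set.univ ≤ 1 := by
  refine le_of_tendsto' (tendsto_finsetSum J fun j _ =>
    tendsto_integral_cut (α j : Measure (E d))) fun R => ?_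
  refine le_of_tendsto (tendsto_finsetSum J fun j _ =>
    hα j _ (continuous_cut R) (hasCompactSupport_cut R)) ?_
  filter_upwards [eventually_sum_cut_le_one ha J R] with i hi
  have hc := continuous_cut (d := d) R
  have hint : ∀ j ∈ J, Integrable (fun x => cut R (x - a j i)) (μ i : Measure (E d)) := fun j _ =>
    (integrable_const (1 : ℝ)).mono' (by fun_prop : Continuous _).aestronglyMeasurable
      (Eventually.of_forall fun x => abs_cut_le_one _ _)
  simp only [integral_translate_neg _ _ hc]
  rw [← integral_finsetSum J hint]
  have := integral_mono (integrable_finsetSum J hint)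
    (integrable_const (μ := (μ i : Measure (E d))) (1 : ℝ)) hi
  simpa using this

theorem measureReal_closedBall_le_integral_translate (μ : Measure (E d)) [IsFiniteMeasure μ]
    (w a : E d) (S : ℝ) {g : E d → ℝ} (hg : Continuous g) (hgc : HasCompactSupport g)
    (h0 : ∀ x, 0 ≤ g x) (h1 : ∀ x, dist x w ≤ S → 1 ≤ g (x - a)) :
    μ.real (Metric.closedBall w S) ≤ ∫ x, g x ∂translate μ (-a) := by
  rw [integral_translate_neg _ _ hg,
    ← integral_indicator_one Metric.isClosed_closedBall.measurableSet]
  obtain ⟨C, hC⟩ := hg.bounded_above_of_compact_support hgc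
  refine integral_mono ((integrable_const (1 : ℝ)).indicator
    Metric.isClosed_closedBall.measurableSet)
    ((integrable_const C).mono' (by fun_prop : Continuous _).aestronglyMeasurable
      (Eventually.of_forall fun x => hC _)) fun x => ?_
  by_cases hx : x ∈ Metric.closedBall w S
  · rw [Set.indicator_of_mem hx]
    exact h1 x hx
  · rw [Set.indicator_of_notMem hx]
    exact h0 _

theorem ne_zero_of_vagueLim_of_closedBall {𝒰 : Ultrafilter ι} {μ : ι → ProbabilityMeasure (E d)}
    {b : ι → E d} {α : FiniteMeasure (E d)} {S δ : ℝ} (hδ : 0 < δ)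
    (hα : VagueLim 𝒰 (fun i => translate (μ i) (-b i)) α)
    (h : ∀ᶠ i in 𝒰, δ < (μ i : Measure (E d)).real (Metric.closedBall (b i) S)) : α ≠ 0 := by
  rintro rfl
  have hlim := hα _ (continuous_cut S) (hasCompactSupport_cut S)
  rw [FiniteMeasure.toMeasure_zero, integral_zero_measure] at hlim
  obtain ⟨i, hi, hi'⟩ := (h.and (hlim.eventually_lt_const hδ)).exists
  refine (hi.trans_le (measureReal_closedBall_le_integral_translate _ _ _ _ (continuous_cut S)
    (hasCompactSupport_cut S) (cut_nonneg S) fun x hx => ?_)).not_gt hi'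
  rw [cut_eq_one (by rwa [← dist_eq_norm])]

namespace IsProfile

variable {𝒰 : Ultrafilter ι} {μ ν : ι → ProbabilityMeasure (E d)}
  {α β : κ → FiniteMeasure (E d)} {a : κ → ι → E d}

theorem summable_mass (h : IsProfile 𝒰 μ ν α β a) :
    Summable fun j => (α j : Measure (E d)).real Set.univ :=
  summable_of_sum_le (fun _ => measureReal_nonneg) (sum_mass_le_one h.vague_left h.separated)

theorem mass_left_le_one (h : IsProfile 𝒰 μ ν α β a) (j : κ) :
    (α j : Measure (E d)).real Set.univ ≤ 1 := by
  simpa using sum_mass_le_one h.vague_left h.separated {j}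

theorem mass_right_le_one (h : IsProfile 𝒰 μ ν α β a) (j : κ) :
    (β j : Measure (E d)).real Set.univ ≤ 1 := by
  simpa using sum_mass_le_one h.vague_right h.separated {j}

/-- Away from finitely many of the centres, no ball of a given radius carries much mass of both
measures: otherwise vague limits around centres of such balls would contradict maximality. -/
theorem exists_small_away (h : IsProfile 𝒰 μ ν α β a) {δ : ℝ} (hδ : 0 < δ) (S : ℝ) :
    ∃ J₁ : Finset κ, ∀ J : Finset κ, J₁ ⊆ J → ∃ R₁ : ℝ, ∀ R, R₁ ≤ R →
      ∀ᶠ i in 𝒰, ∀ w, (∀ j ∈ J, R ≤ dist w (a j i)) →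
        min ((μ i : Measure (E d)).real (Metric.closedBall w S))
          ((ν i : Measure (E d)).real (Metric.closedBall w S)) ≤ δ := by
  have hfin : {j | ¬ (α j : Measure (E d)).real Set.univ < δ}.Finite :=
    h.summable_mass.tendsto_cofinite_zero.eventually_lt_const hδ
  refine ⟨hfin.toFinset, fun J hJ => ?_⟩
  obtain ⟨R₀, hR₀⟩ : ∃ R₀ : ℝ, ∀ j ∈ J, (α j : Measure (E d)).real Set.univ - δ <
      ∫ x, cut R₀ x ∂(α j : Measure (E d)) :=
    ((eventually_all_finset J).2 fun j _ =>
      (tendsto_integral_cut (α j : Measure (E d))).eventually_const_lt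
        (sub_lt_self _ hδ)).exists
  refine ⟨R₀ + 1 + S, fun R hR => ?_⟩
  -- otherwise choose violating centres `w i` and apply maximality to them
  by_contra hcon
  rw [← Ultrafilter.eventually_not] at hcon
  push Not at hcon
  choose! w hw hwδ using fun i (hi : ∃ w, (∀ j ∈ J, R ≤ dist w (a j i)) ∧
    δ < min ((μ i : Measure (E d)).real (Metric.closedBall w S))
      ((ν i : Measure (E d)).real (Metric.closedBall w S))) => hi
  have hμw : ∀ᶠ i in 𝒰, δ < (μ i : Measure (E d)).real (Metric.closedBall (w i) S) :=
    hcon.mono fun i hi => (lt_min_iff.1 (hwδ i hi)).1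
  have hνw : ∀ᶠ i in 𝒰, δ < (ν i : Measure (E d)).real (Metric.closedBall (w i) S) :=
    hcon.mono fun i hi => (lt_min_iff.1 (hwδ i hi)).2
  obtain ⟨α', hα'⟩ := exists_vagueLim 𝒰 fun i => translate (μ i : Measure (E d)) (-w i)
  obtain ⟨β', hβ'⟩ := exists_vagueLim 𝒰 fun i => translate (ν i : Measure (E d)) (-w i)
  obtain ⟨j, T, hT⟩ := h.maximal w α' β' hα' hβ'
    (ne_zero_of_vagueLim_of_closedBall hδ hα' hμw) (ne_zero_of_vagueLim_of_closedBall hδ hβ' hνw)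
  set R' := max (T + S) R₀
  have hcut : ∀ i, ‖w i - a j i‖ ≤ T → ∀ x, dist x (w i) ≤ S → cut R' (x - a j i) = 1 := by
    intro i hi x hx
    refine cut_eq_one (le_trans ?_ (le_max_left _ _))
    have := norm_add_le (x - w i) (w i - a j i)
    rw [sub_add_sub_cancel, ← dist_eq_norm x (w i)] at this
    linarith
  -- the balls around `w i` are far from a centre in `J`, where little of the mass of `α j` lies,
  -- and the limit masses of the other members are below `δ`
  by_cases hj : j ∈ J
  · have hlim := h.vague_left j (fun x => cut R' x - cut R₀ x)
      ((continuous_cut _).sub (continuous_cut _))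
      ((hasCompactSupport_cut _).sub (hasCompactSupport_cut _))
    have hge : δ ≤ ∫ x, (cut R' x - cut R₀ x) ∂(α j : Measure (E d)) := by
      refine ge_of_tendsto hlim ?_
      filter_upwards [hμw, hT, hcon] with i h1 h2 h3
      refine h1.le.trans (measureReal_closedBall_le_integral_translate _ _ _ _
        ((continuous_cut _).sub (continuous_cut _))
        ((hasCompactSupport_cut _).sub (hasCompactSupport_cut _))
        (fun x => sub_nonneg.2 (cut_mono (le_max_right _ _) x)) fun x hx => ?_)
      rw [hcut i h2 x hx, cut_eq_zero, sub_zero]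
      have h4 := hw i h3 j hj
      have h5 := dist_triangle_left (w i) (a j i) x
      rw [← dist_eq_norm]
      linarith
    rw [integral_sub (integrable_cut _ _) (integrable_cut _ _)] at hge
    have := integral_cut_le R' (α j : Measure (E d))
    linarith [hR₀ j hj]
  · have hge : δ ≤ ∫ x, cut R' x ∂(α j : Measure (E d)) := by
      refine ge_of_tendsto (h.vague_left j _ (continuous_cut R') (hasCompactSupport_cut R')) ?_
      filter_upwards [hμw, hT] with i h1 h2
      exact h1.le.trans (measureReal_closedBall_le_integral_translate _ _ _ _ (continuous_cut _)
        (hasCompactSupport_cut _) (cut_nonneg _) fun x hx => (hcut i h2 x hx).ge)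
    have hjs : (α j : Measure (E d)).real Set.univ < δ := by
      by_contra hc
      exact hj (hJ (hfin.mem_toFinset.2 hc))
    linarith [integral_cut_le R' (α j : Measure (E d))]

end IsProfile

/-- Localizing a test function around finitely many centres loses at most the pairs of nearby
points away from all centres, besides the contribution of configurations of large diameter. -/
theorem abs_pairIntegral_sub_sum_le (f : TestFunction d) (μ ν : Measure (E d))
    [IsProbabilityMeasure μ] [IsProbabilityMeasure ν] (b : κ → E d) (J : Finset κ) (R : ℝ)
    {ε S : ℝ} (hS : ∀ z, S < spread z → |f.2.1 z| < ε) (hε : 0 ≤ ε)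
    (hsum : ∀ x, ∑ j ∈ J, cut R (x - b j) ≤ 1) :
    |pairIntegral f μ ν - ∑ j ∈ J, ∫ z, cut R ((z (firstIndex f.1)).1 - b j) * f.2.1 z
        ∂(Measure.pi fun _ => μ.prod ν)| ≤
      ε + ‖f.2.1‖ * (μ.prod ν).real
        {p | p.1 ∈ {x | ∀ j ∈ J, R < dist x (b j)} ∧ ‖p.2 - p.1‖ ≤ S} := by
  set T : Set (E d × E d) := {p | p.1 ∈ {x | ∀ j ∈ J, R < dist x (b j)} ∧ ‖p.2 - p.1‖ ≤ S}
    with hT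
  set M : Measure (Fin (f.1 : ℕ) → E d × E d) := Measure.pi fun _ => μ.prod ν with hM
  have hA : MeasurableSet {x : E d | ∀ j ∈ J, R < dist x (b j)} := by
    have : {x : E d | ∀ j ∈ J, R < dist x (b j)} = ⋂ j ∈ J, {x | R < dist x (b j)} := by
      ext; simp
    rw [this]
    exact Finset.measurableSet_biInter J fun j _ =>
      (isOpen_lt continuous_const (by fun_prop)).measurableSet
  have hTm : MeasurableSet T :=
    (measurable_fst hA).inter
      (isClosed_le (f := fun p : E d × E d => ‖p.2 - p.1‖) (by fun_prop)
        continuous_const).measurableSet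
  have hmp : MeasurePreserving (Function.eval (firstIndex f.1)) M (μ.prod ν) :=
    measurePreserving_eval (fun _ => μ.prod ν) (firstIndex f.1)
  have hTM : MeasurableSet (Function.eval (firstIndex f.1) ⁻¹' T :
      Set (Fin (f.1 : ℕ) → E d × E d)) := hmp.measurable hTm
  have hreal : M.real (Function.eval (firstIndex f.1) ⁻¹' T) = (μ.prod ν).real T := by
    rw [measureReal_def, measureReal_def, hmp.measure_preimage hTm.nullMeasurableSet]
  have hi : ∀ j ∈ J, Integrable
      (fun z => cut R ((z (firstIndex f.1)).1 - b j) * f.2.1 z) M := fun j _ =>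
    integrable_cut_sub_mul f M R (b j)
  rw [← integral_finsetSum J hi, pairIntegral, ← hM,
    ← integral_sub (f.2.1.integrable M) (integrable_finsetSum J hi)]
  have hint : Integrable (fun z => ε +
      ‖f.2.1‖ * (Function.eval (firstIndex f.1) ⁻¹' T).indicator (fun _ => (1 : ℝ)) z) M :=
    (integrable_const _).add (((integrable_const (1 : ℝ)).indicator hTM).const_mul _)
  have hval : ε + ‖f.2.1‖ * (μ.prod ν).real T = ∫ z, (ε +
      ‖f.2.1‖ * (Function.eval (firstIndex f.1) ⁻¹' T).indicator (fun _ => (1 : ℝ)) z) ∂M := by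
    rw [integral_add (integrable_const _) (((integrable_const (1 : ℝ)).indicator hTM).const_mul _),
      integral_const_mul, integral_indicator_const _ hTM, hreal]
    simp
  rw [hval]
  refine norm_integral_le_of_norm_le (μ := M)
    (f := fun z => f.2.1 z - ∑ j ∈ J, cut R ((z (firstIndex f.1)).1 - b j) * f.2.1 z)
    hint (Eventually.of_forall fun z => ?_)
  set x := (z (firstIndex f.1)).1 with hx
  have h0 : 0 ≤ 1 - ∑ j ∈ J, cut R (x - b j) := sub_nonneg.2 (hsum x)
  have h1 : 1 - ∑ j ∈ J, cut R (x - b j) ≤ 1 :=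
    sub_le_self _ (Finset.sum_nonneg fun _ _ => cut_nonneg _ _)
  rw [← Finset.sum_mul, show f.2.1 z - (∑ j ∈ J, cut R (x - b j)) * f.2.1 z =
    (1 - ∑ j ∈ J, cut R (x - b j)) * f.2.1 z by ring, norm_mul, Real.norm_of_nonneg h0]
  by_cases hz : z ∈ Function.eval (firstIndex f.1) ⁻¹' T
  · rw [Set.indicator_of_mem hz, mul_one]
    exact (mul_le_of_le_one_left (norm_nonneg _) h1).trans
      ((f.2.1.norm_coe_le_norm z).trans (le_add_of_nonneg_left hε))
  · rw [Set.indicator_of_notMem hz, mul_zero, add_zero]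
    by_cases hxA : ∀ j ∈ J, R < dist x (b j)
    · have hfar : S < ‖(z (firstIndex f.1)).2 - (z (firstIndex f.1)).1‖ :=
        not_le.1 fun hle => hz ⟨hxA, hle⟩
      exact (mul_le_of_le_one_left (norm_nonneg _) h1).trans
        (hS z (hfar.trans_le (norm_sub_le_spread z _))).le
    · push Not at hxA
      obtain ⟨j, hj, hjx⟩ := hxA
      have h2 : 1 ≤ ∑ j ∈ J, cut R (x - b j) := by
        rw [dist_eq_norm] at hjx
        rw [← cut_eq_one hjx]
        exact Finset.single_le_sum (f := fun j => cut R (x - b j))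
          (fun _ _ => cut_nonneg _ _) hj
      rw [le_antisymm (sub_nonpos.2 h2) h0, zero_mul]
      exact hε

namespace IsProfile

variable {𝒰 : Ultrafilter ι} {μ ν : ι → ProbabilityMeasure (E d)}
  {α β : κ → FiniteMeasure (E d)} {a : κ → ι → E d}

theorem summable_pairIntegral (h : IsProfile 𝒰 μ ν α β a) (f : TestFunction d) :
    Summable fun j => pairIntegral f (α j) (β j) :=
  Summable.of_norm_bounded (h.summable_mass.mul_left ‖f.2.1‖) fun j =>
    abs_pairIntegral_le f _ _ (h.mass_left_le_one j) (h.mass_right_le_one j)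

/-- The integrals of test functions converge to the sum over the profiles. -/
theorem tendsto_pairIntegral (h : IsProfile 𝒰 μ ν α β a) (f : TestFunction d) :
    Tendsto (fun i => pairIntegral f (μ i) (ν i)) 𝒰
      (𝓝 (∑' j, pairIntegral f (α j) (β j))) := by
  rw [Metric.tendsto_nhds]
  intro ε₀ hε₀
  obtain ⟨ε, hε, rfl⟩ : ∃ ε > 0, ε₀ = 5 * ε := ⟨ε₀ / 5, by positivity, by ring⟩
  obtain ⟨S, hS0, hS⟩ := exists_spread_bound f hε
  set C := ‖f.2.1‖
  have hC : 0 ≤ C := norm_nonneg _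
  set v := volume.real (Metric.closedBall (0 : E d) S) with hv
  set v₂ := volume.real (Metric.closedBall (0 : E d) (2 * S)) with hv₂
  have hvpos : 0 < v := ENNReal.toReal_pos (Metric.measure_closedBall_pos _ _ hS0).ne'
    measure_closedBall_lt_top.ne
  have hv₂0 : 0 ≤ v₂ := measureReal_nonneg
  -- with this `δ`, `prod_near_le` bounds the contribution of nearby pairs away from the centres
  -- by `ε`
  set δ := ε * v / (2 * (v₂ + 1) * (C + 1)) with hδ
  have hδpos : 0 < δ := by positivity
  obtain ⟨J₁, hJ₁⟩ := h.exists_small_away hδpos (2 * S)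
  obtain ⟨J, hJ₁J, hJsum⟩ := ((eventually_ge_atTop J₁).and
    ((Metric.tendsto_nhds.1 (h.summable_pairIntegral f).hasSum) ε hε)).exists
  obtain ⟨R₁, hR₁⟩ := hJ₁ J hJ₁J
  obtain ⟨R, hRR, hRlim⟩ := ((eventually_ge_atTop (R₁ + S)).and
    (Metric.tendsto_nhds.1 (tendsto_finsetSum J fun j _ =>
      tendsto_integral_cut_mul f (α j : Measure (E d)) (β j)) ε hε)).exists
  have hcut := continuous_cut (d := d) R
  have hloc := tendsto_finsetSum J fun j _ =>
    (h.vague_left j).tendsto_integral_pi (h.vague_right j)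
      ((hcut.comp (by fun_prop)).mul f.2.1.continuous) (tendsto_cut_mul_cocompact f R)
  filter_upwards [eventually_sum_cut_le_one h.separated J R, hR₁ (R - S) (by linarith),
    (Metric.tendsto_nhds.1 hloc) ε hε] with i hi1 hi2 hi3
  have hmain := abs_pairIntegral_sub_sum_le f (μ i : Measure (E d)) (ν i) (fun j => a j i) J R
    hS hε.le hi1
  set A : Set (E d) := {x | ∀ j ∈ J, R < dist x (a j i)} with hA
  have hAm : MeasurableSet A := by
    have : A = ⋂ j ∈ J, {x | R < dist x (a j i)} := by ext; simp [hA]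
    rw [this]
    exact Finset.measurableSet_biInter J fun j _ =>
      (isOpen_lt continuous_const (by fun_prop)).measurableSet
  have hnear := prod_near_le (μ i : Measure (E d)) (ν i) hAm S (ENNReal.ofReal δ) <| by
    rintro w ⟨x, hx, hxw⟩
    have := hi2 w fun j hj => by
      have h1 := hx j hj
      have h2 := dist_triangle x w (a j i)
      linarith
    rcases min_le_iff.1 this with h' | h'
    · exact (min_le_left _ _).trans
        ((ENNReal.le_ofReal_iff_toReal_le (measure_ne_top _ _) hδpos.le).2 h')
    · exact (min_le_right _ _).trans
        ((ENNReal.le_ofReal_iff_toReal_le (measure_ne_top _ _) hδpos.le).2 h')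
  set q := ((μ i : Measure (E d)).prod (ν i : Measure (E d))).real
    {p | p.1 ∈ A ∧ ‖p.2 - p.1‖ ≤ S} with hq
  have hq' : q * v ≤ δ * (2 * v₂) := by
    have := ENNReal.toReal_mono (ENNReal.mul_ne_top ENNReal.ofReal_ne_top
      (ENNReal.mul_ne_top (by simp) measure_closedBall_lt_top.ne)) hnear
    simpa [ENNReal.toReal_mul, ENNReal.toReal_ofReal hδpos.le, hq, hv, hv₂, measureReal_def]
      using this
  have hqε : C * q ≤ ε := by
    have h1 : δ * (2 * v₂) ≤ ε * v / (C + 1) := by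
      rw [hδ, div_mul_eq_mul_div, div_le_div_iff₀ (by positivity) (by positivity)]
      have : 0 ≤ ε * v * (C + 1) := by positivity
      nlinarith
    have h2 : q ≤ ε / (C + 1) := by
      have := hq'.trans h1
      rw [mul_div_right_comm] at this
      exact le_of_mul_le_mul_right this hvpos
    calc C * q ≤ (C + 1) * (ε / (C + 1)) := by
          apply mul_le_mul (by linarith) h2 measureReal_nonneg (by linarith)
      _ = ε := by field_simp
  simp only [integral_cut_sub_mul] at hmain
  rw [Real.dist_eq] at *
  simp only [Function.comp_def, Pi.mul_apply] at hi3
  have hmain' := hmain.trans (add_le_add_right hqε ε)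
  rw [abs_le] at hmain'
  rw [abs_lt] at *
  constructor <;> linarith [hmain'.1, hmain'.2, hi3.1, hi3.2, hRlim.1, hRlim.2, hJsum.1, hJsum.2]

end IsProfile

/-! ### Existence of profiles -/

/-- Sequences of centres are equivalent along `l` if their distances are eventually bounded. -/
def boundedDistance (d : ℕ) (l : Filter ι) : Setoid (ι → E d) where
  r a b := ∃ T : ℝ, ∀ᶠ i in l, ‖a i - b i‖ ≤ T
  iseqv :=
    { refl := fun a => ⟨0, by simp⟩
      symm := fun ⟨T, hT⟩ => ⟨T, by simpa only [norm_sub_rev] using hT⟩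
      trans := by
        rintro a b c ⟨T, hT⟩ ⟨T', hT'⟩
        refine ⟨T + T', ?_⟩
        filter_upwards [hT, hT'] with i h h'
        have := norm_add_le (a i - b i) (b i - c i)
        rw [sub_add_sub_cancel] at this
        linarith }

/-- Vague limits around centres at bounded distance are both zero or both nonzero. -/
theorem VagueLim.ne_zero_of_bounded {𝒰 : Ultrafilter ι} {μ : ι → ProbabilityMeasure (E d)}
    {a b : ι → E d} {α α' : FiniteMeasure (E d)}
    (hα : VagueLim 𝒰 (fun i => translate (μ i) (-a i)) α)
    (hα' : VagueLim 𝒰 (fun i => translate (μ i) (-b i)) α') {T : ℝ}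
    (hT : ∀ᶠ i in 𝒰, ‖b i - a i‖ ≤ T) (h0 : α' ≠ 0) : α ≠ 0 := by
  rintro rfl
  have hpos := measureReal_univ_pos h0
  obtain ⟨R, hR⟩ :=
    ((tendsto_integral_cut (α' : Measure (E d))).eventually_const_lt hpos).exists
  have hlim := hα _ (continuous_cut (R + 1 + T)) (hasCompactSupport_cut _)
  rw [FiniteMeasure.toMeasure_zero, integral_zero_measure] at hlim
  have hlim' := hα' _ (continuous_cut R) (hasCompactSupport_cut _)
  refine (le_of_tendsto_of_tendsto hlim' hlim ?_).not_gt hR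
  filter_upwards [hT] with i hi
  simp only [integral_translate_neg _ _ (continuous_cut (d := d) _)]
  have hint : ∀ (R : ℝ) (c : E d), Integrable (fun x => cut R (x - c)) (μ i : Measure (E d)) :=
    fun R c => by
      have hc := continuous_cut (d := d) R
      exact (integrable_const (1 : ℝ)).mono' (by fun_prop : Continuous _).aestronglyMeasurable
        (Eventually.of_forall fun x => abs_cut_le_one _ _)
  refine integral_mono (hint _ _) (hint _ _) fun x => ?_
  by_cases hx : R + 1 ≤ ‖x - b i‖
  · simp only [cut_eq_zero hx]
    exact cut_nonneg _ _
  · have := norm_add_le (x - b i) (b i - a i)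
    rw [sub_add_sub_cancel] at this
    simp only [cut_eq_one (R := R + 1 + T) (x := x - a i) (by linarith)]
    exact cut_le_one _ _

/-- Every choice of pairs of probability measures has a profile decomposition along an ultrafilter:
the centres represent the classes of sequences at bounded distance, and the vague limits exist by
compactness. -/
theorem exists_isProfile.{u} {ι : Type u} (𝒰 : Ultrafilter ι)
    (μ ν : ι → ProbabilityMeasure (E d)) :
    ∃ (κ : Type u) (_ : Countable κ) (α β : κ → FiniteMeasure (E d)) (a : κ → ι → E d),
      IsProfile 𝒰 μ ν α β a := by
  choose A hA using fun b : ι → E d =>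
    exists_vagueLim 𝒰 fun i => translate (μ i : Measure (E d)) (-b i)
  choose B hB using fun b : ι → E d =>
    exists_vagueLim 𝒰 fun i => translate (ν i : Measure (E d)) (-b i)
  let κ := {q : Quotient (boundedDistance d (𝒰 : Filter ι)) // A q.out ≠ 0 ∧ B q.out ≠ 0}
  have hprof : IsProfile 𝒰 μ ν (fun q : κ => A q.1.out) (fun q : κ => B q.1.out)
      (fun q : κ => q.1.out) :=
    { vague_left := fun j => hA _
      vague_right := fun j => hB _
      separated := by
        intro j j' hne
        rw [tendsto_atTop]
        intro T
        by_contra hcon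
        rw [← Ultrafilter.eventually_not] at hcon
        refine hne (Subtype.ext ?_)
        rw [← Quotient.out_eq j.1, ← Quotient.out_eq j'.1]
        exact Quotient.sound ⟨T, hcon.mono fun i hi => (not_le.1 hi).le⟩
      maximal := by
        intro b α' β' hα' hβ' h1 h2
        obtain ⟨T, hT⟩ : boundedDistance d (𝒰 : Filter ι) b
            (Quotient.mk (boundedDistance d (𝒰 : Filter ι)) b).out :=
          Setoid.symm' _ (Quotient.mk_out (s := boundedDistance d (𝒰 : Filter ι)) b)
        exact ⟨⟨_, (hA _).ne_zero_of_bounded hα' hT h1, (hB _).ne_zero_of_bounded hβ' hT h2⟩,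
          T, hT⟩ }
  refine ⟨κ, ?_, _, _, _, hprof⟩
  have hc := hprof.summable_mass.countable_support
  have huniv : Function.support (fun j : κ => (A j.1.out : Measure (E d)).real Set.univ) =
      Set.univ := by
    exact Set.eq_univ_of_forall fun j => (measureReal_univ_pos j.2.1).ne'
  rw [huniv] at hc
  exact Set.countable_univ_iff.1 hc

theorem tsum_mass_le_one {α : κ → FiniteMeasure (E d)}
    (h : ∀ J : Finset κ, ∑ j ∈ J, (α j : Measure (E d)).real Set.univ ≤ 1) :
    ∑' j, (α j : Measure (E d)) Set.univ ≤ 1 := by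
  rw [ENNReal.tsum_eq_iSup_sum]
  refine iSup_le fun J => ?_
  have : ∑ j ∈ J, (α j : Measure (E d)) Set.univ =
      ENNReal.ofReal (∑ j ∈ J, (α j : Measure (E d)).real Set.univ) := by
    rw [ENNReal.ofReal_sum_of_nonneg fun _ _ => measureReal_nonneg]
    exact Finset.sum_congr rfl fun j _ => by simp
  rw [this]
  exact ENNReal.ofReal_le_one.2 (h J)

/-- Along an ultrafilter every choice of pairs of probability measures has a limit collection, each
member of which is a vague limit of suitable translates. -/
theorem exists_limit_family (𝒰 : Ultrafilter ι) (μ ν : ι → ProbabilityMeasure (E d)) :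
    ∃ F : PairFamily d,
      (∀ f : TestFunction d, Tendsto (fun i => pairIntegral f (μ i) (ν i)) 𝒰
        (𝓝 (∑' n, pairIntegral f (F.α n) (F.β n)))) ∧
      ∀ n, F.prod n ≠ 0 → ∃ a : ι → E d,
        VagueLim 𝒰 (fun i => translate (μ i) (-a i)) (F.α n) ∧
        VagueLim 𝒰 (fun i => translate (ν i) (-a i)) (F.β n) := by
  obtain ⟨κ, _, α, β, a, h⟩ := exists_isProfile 𝒰 μ ν
  obtain ⟨e, he⟩ := Countable.exists_injective_nat κ
  -- the members are placed at the indices `e j`; the other terms are zero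
  have hext : ∀ (α : κ → FiniteMeasure (E d)) n, n ∉ Set.range e →
      Function.extend e α 0 n = 0 := fun α n hn => Function.extend_apply' _ _ _ hn
  have hsum : ∀ α : κ → FiniteMeasure (E d), ∑' j, (α j : Measure (E d)) Set.univ ≤ 1 →
      ∑' n, ((Function.extend e α 0 n : FiniteMeasure (E d)) : Measure (E d)) Set.univ ≤ 1 := by
    intro α hα
    rw [← he.tsum_eq]
    · simpa only [he.extend_apply] using hα
    · intro n hn
      by_contra hne
      exact hn (by simp [hext α n hne])
  refine ⟨⟨Function.extend e α 0, Function.extend e β 0,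
    hsum α (tsum_mass_le_one (sum_mass_le_one h.vague_left h.separated)),
    hsum β (tsum_mass_le_one (sum_mass_le_one h.vague_right h.separated))⟩, fun f => ?_, ?_⟩
  · simp only
    rw [← he.tsum_eq]
    · simpa only [he.extend_apply] using h.tendsto_pairIntegral f
    · intro n hn
      by_contra hne
      exact hn (pairIntegral_eq_zero f _ _ (by simp [hext _ n hne]))
  · intro n hn
    by_cases hne : n ∈ Set.range e
    · obtain ⟨j, rfl⟩ := hne
      refine ⟨a j, ?_, ?_⟩ <;> simp only [he.extend_apply]
      · exact h.vague_left j
      · exact h.vague_right j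
    · exact absurd (by simp [PairFamily.prod, hext _ n hne]) hn

/-! ### Measures determined by moments -/

/-- Finite measures are determined by the integrals of all finite products of a point separating
family of bounded continuous functions. -/
theorem ext_of_forall_integral_prod_eq {P : Type*} [TopologicalSpace P] [PolishSpace P]
    [MeasurableSpace P] [BorelSpace P] {m m' : Measure P} [IsFiniteMeasure m] [IsFiniteMeasure m']
    (c : ι → P →ᵇ ℝ) (hc : ∀ x y, x ≠ y → ∃ j, c j x ≠ c j y)
    (h : ∀ (n : ℕ) (w : Fin n → ι), ∫ x, ∏ i, c (w i) x ∂m = ∫ x, ∏ i, c (w i) x ∂m') :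
    m = m' := by
  let A : StarSubalgebra ℝ (P →ᵇ ℝ) :=
    { Algebra.adjoin ℝ (Set.range c) with
      star_mem' := fun {f} hf => by
        have : star f = f := by ext x; simp
        rwa [this] }
  refine ext_of_forall_mem_subalgebra_integral_eq_of_polish (𝕜 := ℝ) (A := A) ?_ ?_
  · intro x y hxy
    obtain ⟨j, hj⟩ := hc x y hxy
    exact ⟨_, ⟨(c j).toContinuousMap, ⟨c j, Algebra.subset_adjoin ⟨j, rfl⟩, rfl⟩, rfl⟩, hj⟩
  · intro g hg
    replace hg : g ∈ Subalgebra.toSubmodule (Algebra.adjoin ℝ (Set.range c)) := hg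
    rw [Algebra.adjoin_eq_span] at hg
    induction hg using Submodule.span_induction with
    | mem g hg =>
      obtain ⟨n, w, rfl⟩ : ∃ (n : ℕ) (w : Fin n → ι), g = ∏ i, c (w i) := by
        induction hg using Submonoid.closure_induction with
        | mem g hg =>
          obtain ⟨j, rfl⟩ := hg
          exact ⟨1, fun _ => j, by simp⟩
        | one => exact ⟨0, Fin.elim0, by simp⟩
        | mul g g' _ _ hg hg' =>
          obtain ⟨n, w, rfl⟩ := hg
          obtain ⟨n', w', rfl⟩ := hg'
          exact ⟨n + n', Fin.append w w', by simp [Fin.prod_univ_add]⟩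
      simpa using h n w
    | zero => simp
    | add g g' _ _ hg hg' =>
      simp only [BoundedContinuousFunction.coe_add, Pi.add_apply]
      rw [integral_add (g.integrable _) (g'.integrable _),
        integral_add (g.integrable _) (g'.integrable _), hg, hg']
    | smul r g _ hg =>
      simp only [BoundedContinuousFunction.coe_smul, integral_smul, hg]

/-! ### Local statistics of a product measure -/

/-- A positive weight vanishing at infinity. -/
noncomputable def weight {V : Type*} [NormedAddCommGroup V] (v : V) : ℝ := 1 / (1 + ‖v‖)

section weight

variable {V : Type*} [NormedAddCommGroup V]

theorem weight_pos (v : V) : 0 < weight v := by unfold weight; positivity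

theorem weight_le_one (v : V) : weight v ≤ 1 := by
  unfold weight
  exact div_le_one_of_le₀ (by linarith [norm_nonneg v]) (by positivity)

theorem continuous_weight : Continuous (weight : V → ℝ) := by
  unfold weight
  exact continuous_const.div (by fun_prop) fun v => by positivity

end weight

/-- The distance to the `l`-th member of a dense sequence, truncated at `1`. -/
noncomputable def truncDist (d : ℕ) (l : ℕ) (z : E d × E d) : ℝ :=
  min 1 (dist z (TopologicalSpace.denseSeq (E d × E d) l))

theorem truncDist_nonneg (l : ℕ) (z : E d × E d) : 0 ≤ truncDist d l z :=
  le_min zero_le_one dist_nonneg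

theorem truncDist_le_one (l : ℕ) (z : E d × E d) : truncDist d l z ≤ 1 := min_le_left _ _

theorem continuous_truncDist (l : ℕ) : Continuous (truncDist d l) := by
  unfold truncDist
  fun_prop

theorem exists_truncDist_ne {x y : E d × E d} (h : x ≠ y) :
    ∃ l, truncDist d l x ≠ truncDist d l y := by
  have hr : 0 < min 1 (dist x y) / 2 := by
    have := dist_pos.2 h
    positivity
  obtain ⟨l, hl⟩ :=
    Metric.denseRange_iff.1 (TopologicalSpace.denseRange_denseSeq (E d × E d)) x _ hr
  refine ⟨l, ne_of_lt ?_⟩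
  unfold truncDist
  set q := TopologicalSpace.denseSeq (E d × E d) l
  have h1 := dist_triangle_left x y q
  rw [dist_comm q x, dist_comm q y] at h1
  refine (min_le_right _ _).trans_lt (lt_min ?_ ?_)
  · linarith [min_le_left 1 (dist x y)]
  · linarith [min_le_right 1 (dist x y)]

/-- Indices of finite products of truncated distances. -/
abbrev Word : Type := Σ n : ℕ, Fin n → ℕ

/-- The weighted products of truncated distances: they vanish at infinity and determine finite
measures. -/
noncomputable def statistic (w : Word) (z : E d × E d) : ℝ := weight z * ∏ i, truncDist d (w.2 i) z

theorem statistic_nonneg (w : Word) (z : E d × E d) : 0 ≤ statistic w z :=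
  mul_nonneg (weight_pos z).le (Finset.prod_nonneg fun _ _ => truncDist_nonneg _ _)

theorem statistic_le_weight (w : Word) (z : E d × E d) : statistic w z ≤ weight z :=
  mul_le_of_le_one_right (weight_pos z).le
    (Finset.prod_le_one (fun _ _ => truncDist_nonneg _ _) fun _ _ => truncDist_le_one _ _)

theorem statistic_le_one (w : Word) (z : E d × E d) : statistic w z ≤ 1 :=
  (statistic_le_weight w z).trans (weight_le_one z)

theorem continuous_statistic (w : Word) : Continuous (statistic w : E d × E d → ℝ) := by
  have h1 := continuous_weight (V := E d × E d)
  have h2 := fun l => continuous_truncDist (d := d) l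
  unfold statistic
  fun_prop

/-- The statistics determine finite measures. -/
theorem ext_of_forall_integral_statistic {γ γ' : Measure (E d × E d)} [IsFiniteMeasure γ]
    [IsFiniteMeasure γ'] (h : ∀ w, ∫ z, statistic w z ∂γ = ∫ z, statistic w z ∂γ') : γ = γ' := by
  have hm : Measurable fun z : E d × E d => ENNReal.ofReal (weight z) :=
    continuous_weight.measurable.ennreal_ofReal
  have hfin : ∀ (γ : Measure (E d × E d)) [IsFiniteMeasure γ],
      IsFiniteMeasure (γ.withDensity fun z => ENNReal.ofReal (weight z)) := by
    intro γ _
    refine isFiniteMeasure_withDensity_ofReal ?_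
    exact ((integrable_const (1 : ℝ)).mono' continuous_weight.aestronglyMeasurable
      (Eventually.of_forall fun z => by
        rw [Real.norm_of_nonneg (weight_pos z).le]; exact weight_le_one z)).2
  have hinv : ∀ γ : Measure (E d × E d),
      (γ.withDensity fun z => ENNReal.ofReal (weight z)).withDensity
      (fun z => ENNReal.ofReal (weight z))⁻¹ = γ := fun γ =>
    withDensity_inv_same hm
      (Eventually.of_forall fun z => (ENNReal.ofReal_pos.2 (weight_pos z)).ne')
      (Eventually.of_forall fun z => ENNReal.ofReal_ne_top)
  have := hfin γ
  have := hfin γ'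
  rw [← hinv γ, ← hinv γ']
  congr 1
  let c : ℕ → (E d × E d) →ᵇ ℝ := fun l =>
    BoundedContinuousFunction.ofNormedAddCommGroup (truncDist d l) (continuous_truncDist l) 1
      fun z => by
        rw [Real.norm_of_nonneg (truncDist_nonneg _ _)]
        exact truncDist_le_one l z
  refine ext_of_forall_integral_prod_eq c (fun x y hxy => exists_truncDist_ne hxy) fun n w => ?_
  have key : ∀ γ : Measure (E d × E d),
      ∫ x, ∏ i, c (w i) x ∂(γ.withDensity fun z => ENNReal.ofReal (weight z)) =
        ∫ z, statistic ⟨n, w⟩ z ∂γ := by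
    intro γ
    rw [integral_withDensity_eq_integral_toReal_smul hm
      (Eventually.of_forall fun z => ENNReal.ofReal_lt_top)]
    refine integral_congr_ae (Eventually.of_forall fun z => ?_)
    simp only [ENNReal.toReal_ofReal (weight_pos z).le, smul_eq_mul]
    rfl
  rw [key, key]
  exact h _

/-- The translate `(α ⋆ δ_x) ⊗ (β ⋆ δ_x)` of a product measure along the diagonal. -/
noncomputable def shiftProd (α β : Measure (E d)) (x : E d) : Measure (E d × E d) :=
  (translate α x).prod (translate β x)

instance (α β : Measure (E d)) [IsFiniteMeasure α] [IsFiniteMeasure β] (x : E d) :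
    IsFiniteMeasure (shiftProd α β x) := by
  unfold shiftProd; infer_instance

theorem shiftProd_eq_map (α β : Measure (E d)) [IsFiniteMeasure α] [IsFiniteMeasure β] (x : E d) :
    shiftProd α β x = (α.prod β).map (fun p => p + (x, x)) :=
  Measure.map_prod_map _ _ (measurable_add_const x) (measurable_add_const x)

theorem map_shiftProd (α β : Measure (E d)) [IsFiniteMeasure α] [IsFiniteMeasure β] (x y : E d) :
    (shiftProd α β x).map (fun p => p + (y, y)) = shiftProd α β (x + y) := by
  rw [shiftProd_eq_map, shiftProd_eq_map, Measure.map_map (measurable_add_const _)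
    (measurable_add_const _)]
  congr 1
  ext p <;> simp [add_assoc]

theorem shiftProd_mem_diagOrbit (α β : Measure (E d)) (x : E d) :
    shiftProd α β x ∈ diagOrbit α β := ⟨x, rfl⟩

theorem diagOrbit_subset_of_shiftProd_eq {α β α' β' : Measure (E d)} [IsFiniteMeasure α]
    [IsFiniteMeasure β] [IsFiniteMeasure α'] [IsFiniteMeasure β'] {x x' : E d}
    (h : shiftProd α β x = shiftProd α' β' x') : diagOrbit α β ⊆ diagOrbit α' β' := by
  rintro _ ⟨y, rfl⟩
  have h1 := map_shiftProd α β x (y - x)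
  rw [h, map_shiftProd, add_sub_cancel] at h1
  exact ⟨_, h1⟩

theorem diagOrbit_eq_of_shiftProd_eq {α β α' β' : Measure (E d)} [IsFiniteMeasure α]
    [IsFiniteMeasure β] [IsFiniteMeasure α'] [IsFiniteMeasure β'] {x x' : E d}
    (h : shiftProd α β x = shiftProd α' β' x') : diagOrbit α β = diagOrbit α' β' :=
  (diagOrbit_subset_of_shiftProd_eq h).antisymm (diagOrbit_subset_of_shiftProd_eq h.symm)

theorem integral_shiftProd_neg (α β : Measure (E d)) [IsFiniteMeasure α] [IsFiniteMeasure β]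
    (x : E d) {g : E d × E d → ℝ} (hg : Continuous g) :
    ∫ z, g z ∂shiftProd α β (-x) = ∫ z, g (z - (x, x)) ∂(α.prod β) := by
  rw [shiftProd_eq_map, integral_map (measurable_add_const _).aemeasurable hg.aestronglyMeasurable]
  rfl

/-- The statistics of `α ⊗ β` seen from the point `x`, as a point of a compact space. -/
noncomputable def view (α β : Measure (E d)) (x : E d) : Word → unitInterval := fun w =>
  Set.projIcc 0 1 zero_le_one (∫ z, statistic w z ∂shiftProd α β (-x))

theorem shiftProd_univ (α β : Measure (E d)) [IsFiniteMeasure α] [IsFiniteMeasure β] (x : E d) :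
    (shiftProd α β x).real Set.univ = α.real Set.univ * β.real Set.univ := by
  rw [shiftProd, measureReal_def, ← Set.univ_prod_univ, Measure.prod_prod, translate_univ,
    translate_univ, ENNReal.toReal_mul]
  rfl

theorem coe_view {α β : Measure (E d)} [IsFiniteMeasure α] [IsFiniteMeasure β]
    (hα : α.real Set.univ ≤ 1) (hβ : β.real Set.univ ≤ 1) (x : E d) (w : Word) :
    (view α β x w : ℝ) = ∫ z, statistic w z ∂shiftProd α β (-x) := by
  have h1 : ∫ z, statistic w z ∂shiftProd α β (-x) ≤ 1 := by
    have h2 := integral_mono_of_nonneg (μ := shiftProd α β (-x))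
      (Eventually.of_forall (statistic_nonneg w)) (integrable_const (1 : ℝ))
      (Eventually.of_forall (statistic_le_one w))
    rw [integral_const, shiftProd_univ, smul_eq_mul, mul_one] at h2
    exact h2.trans (mul_le_one₀ hα measureReal_nonneg hβ)
  rw [view, Set.projIcc_of_mem zero_le_one
    ⟨integral_nonneg (statistic_nonneg w), h1⟩]

theorem continuous_view (α β : Measure (E d)) [IsFiniteMeasure α] [IsFiniteMeasure β] :
    Continuous (view α β) := by
  refine continuous_pi fun w => continuous_projIcc.comp ?_
  simp only [integral_shiftProd_neg _ _ _ (continuous_statistic (d := d) w)]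
  have h := continuous_statistic (d := d) w
  refine continuous_of_dominated (F := fun x z => statistic w (z - (x, x))) (bound := fun _ => 1)
    (fun x => by fun_prop)
    (fun x => Eventually.of_forall fun z => ?_) (integrable_const _)
    (Eventually.of_forall fun z => by fun_prop)
  rw [Real.norm_of_nonneg (statistic_nonneg _ _)]
  exact statistic_le_one _ _

theorem diagOrbit_eq_of_view_eq {α β α' β' : Measure (E d)} [IsFiniteMeasure α]
    [IsFiniteMeasure β] [IsFiniteMeasure α'] [IsFiniteMeasure β']
    (hα : α.real Set.univ ≤ 1) (hβ : β.real Set.univ ≤ 1) (hα' : α'.real Set.univ ≤ 1)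
    (hβ' : β'.real Set.univ ≤ 1) {x x' : E d} (h : view α β x = view α' β' x') :
    diagOrbit α β = diagOrbit α' β' := by
  refine diagOrbit_eq_of_shiftProd_eq (x := -x) (x' := -x')
    (ext_of_forall_integral_statistic fun w => ?_)
  rw [← coe_view hα hβ, ← coe_view hα' hβ', h]

theorem range_view_subset {α β α' β' : Measure (E d)}
    (h : diagOrbit α β = diagOrbit α' β') : Set.range (view α β) ⊆ Set.range (view α' β') := by
  rintro _ ⟨x, rfl⟩
  obtain ⟨y, hy⟩ : shiftProd α β (-x) ∈ diagOrbit α' β' := h ▸ shiftProd_mem_diagOrbit α β (-x)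
  refine ⟨-y, funext fun w => ?_⟩
  rw [view, view, neg_neg, ← hy]
  rfl

theorem measurableSet_range_view (α β : Measure (E d)) [IsFiniteMeasure α] [IsFiniteMeasure β] :
    MeasurableSet (Set.range (view α β)) := by
  obtain ⟨K, hK, hU⟩ := isSigmaCompact_range (continuous_view α β)
  rw [← hU]
  exact MeasurableSet.iUnion fun n => (hK n).measurableSet

/-! ### Collections are determined by the integrals of test functions -/

/-- The product of the weight of the first pair and of statistics of the other pairs seen from the
first point. -/
noncomputable def momentFun {n : ℕ} (w : Fin n → Word) (z : Fin (n + 1) → E d × E d) : ℝ :=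
  weight ((z 0).2 - (z 0).1) * ∏ i, statistic (w i) (z i.succ - ((z 0).1, (z 0).1))

theorem continuous_momentFun {n : ℕ} (w : Fin n → Word) :
    Continuous (momentFun w : (Fin (n + 1) → E d × E d) → ℝ) := by
  have h1 := continuous_weight (V := E d)
  have h2 := fun w => continuous_statistic (d := d) w
  unfold momentFun
  fun_prop

theorem momentFun_nonneg {n : ℕ} (w : Fin n → Word) (z : Fin (n + 1) → E d × E d) :
    0 ≤ momentFun w z :=
  mul_nonneg (weight_pos _).le (Finset.prod_nonneg fun _ _ => statistic_nonneg _ _)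

theorem weight_le_of_le {V : Type*} [NormedAddCommGroup V] {v : V} {r : ℝ} (hr : 0 ≤ r)
    (h : r ≤ ‖v‖) : weight v ≤ 1 / (1 + r) := by
  unfold weight
  exact one_div_le_one_div_of_le (by linarith) (by linarith)

theorem momentFun_le {n : ℕ} (w : Fin n → Word) (z : Fin (n + 1) → E d × E d) :
    momentFun w z ≤ 1 / (1 + spread z / 3) := by
  have hs : 0 ≤ spread z := Metric.diam_nonneg
  have hprod : ∏ i, statistic (w i) (z i.succ - ((z 0).1, (z 0).1)) ≤ 1 :=
    Finset.prod_le_one (fun _ _ => statistic_nonneg _ _) fun _ _ => statistic_le_one _ _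
  have hprod0 : 0 ≤ ∏ i, statistic (w i) (z i.succ - ((z 0).1, (z 0).1)) :=
    Finset.prod_nonneg fun _ _ => statistic_nonneg _ _
  by_cases h0 : spread z / 3 ≤ ‖(z 0).2 - (z 0).1‖
  · exact (mul_le_of_le_one_right (weight_pos _).le hprod).trans
      (weight_le_of_le (by positivity) h0)
  by_cases h1 : ∃ i : Fin n, spread z / 3 ≤ ‖z i.succ - ((z 0).1, (z 0).1)‖
  · obtain ⟨i, hi⟩ := h1
    refine (mul_le_of_le_one_left hprod0 (weight_le_one _)).trans ?_
    rw [← Finset.mul_prod_erase _ _ (Finset.mem_univ i)]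
    refine (mul_le_of_le_one_right (statistic_nonneg _ _)
      (Finset.prod_le_one (fun _ _ => statistic_nonneg _ _) fun _ _ => statistic_le_one _ _)).trans
      ((statistic_le_weight _ _).trans (weight_le_of_le (by positivity) hi))
  -- all points are within a third of the diameter from the first one, so the diameter is zero
  push Not at h0 h1
  have hx : ∀ y ∈ Set.range (fun i => (z i).1) ∪ Set.range (fun i => (z i).2),
      dist y (z 0).1 ≤ spread z / 3 := by
    have hz : ∀ i, ‖z i - ((z 0).1, (z 0).1)‖ ≤ spread z / 3 := by
      intro i
      refine Fin.cases ?_ (fun i => (h1 i).le) i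
      rw [Prod.norm_def]
      refine max_le ?_ h0.le
      simp only [Prod.fst_sub, sub_self, norm_zero]
      positivity
    rintro y (⟨i, rfl⟩ | ⟨i, rfl⟩)
    · rw [dist_eq_norm]
      exact (norm_fst_le (z i - ((z 0).1, (z 0).1))).trans (hz i)
    · rw [dist_eq_norm]
      exact (norm_snd_le (z i - ((z 0).1, (z 0).1))).trans (hz i)
  have hd : spread z ≤ 2 * (spread z / 3) :=
    Metric.diam_le_of_forall_dist_le (by positivity) fun x hxm y hym => by
      linarith [dist_triangle_right x y (z 0).1, hx x hxm, hx y hym]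
  have : spread z = 0 := by linarith
  rw [this, zero_div, add_zero, div_one]
  exact mul_le_one₀ (weight_le_one _) hprod0 hprod

theorem momentFun_le_one {n : ℕ} (w : Fin n → Word) (z : Fin (n + 1) → E d × E d) :
    momentFun w z ≤ 1 := by
  have hs : 0 ≤ spread z := Metric.diam_nonneg
  exact (momentFun_le w z).trans (div_le_one_of_le₀ (by linarith) (by linarith))

theorem momentFun_diagShift {n : ℕ} (w : Fin n → Word) (a : E d) (z : Fin (n + 1) → E d × E d) :
    momentFun w (diagShift a z) = momentFun w z := by
  have h : ∀ i, diagShift a z i - ((diagShift a z 0).1, (diagShift a z 0).1) =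
      z i - ((z 0).1, (z 0).1) := fun i => by ext <;> simp [diagShift]
  simp only [momentFun, h]
  simp [diagShift]

/-- `momentFun` as a test function. -/
noncomputable def momentTest (d : ℕ) {n : ℕ} (w : Fin n → Word) : TestFunction d :=
  ⟨n.succPNat, ⟨BoundedContinuousFunction.ofNormedAddCommGroup (momentFun w)
    (continuous_momentFun w) 1 fun z => by
      rw [Real.norm_of_nonneg (momentFun_nonneg w z)]
      exact momentFun_le_one w z,
    momentFun_diagShift w, by
      refine squeeze_zero (fun z => momentFun_nonneg w z) (fun z => momentFun_le w z) ?_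
      have h : Tendsto (fun s : ℝ => 1 / (1 + s / 3)) atTop (𝓝 0) := by
        simp only [one_div]
        exact tendsto_inv_atTop_zero.comp (tendsto_atTop_add_const_left _ _
          (tendsto_id.atTop_div_const (by norm_num)))
      exact h.comp tendsto_comap⟩⟩

theorem pairIntegral_momentTest {n : ℕ} (w : Fin n → Word) (α β : Measure (E d))
    [IsFiniteMeasure α] [IsFiniteMeasure β] :
    pairIntegral (momentTest d w) α β = ∫ p, weight (p.2 - p.1) *
      ∏ i, ∫ z, statistic (w i) z ∂shiftProd α β (-p.1) ∂(α.prod β) := by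
  set γ := α.prod β with hγ
  have hmp := (measurePreserving_piFinSuccAbove (fun _ : Fin (n + 1) => γ) 0).symm
  change ∫ z, momentFun w z ∂(Measure.pi fun _ : Fin (n + 1) => γ) = _
  rw [← hmp.integral_comp']
  have hcoe : ∀ q : (E d × E d) × (Fin n → E d × E d),
      (MeasurableEquiv.piFinSuccAbove (fun _ : Fin (n + 1) => E d × E d) 0).symm q =
        Fin.cons q.1 q.2 := fun q => by
    simp [MeasurableEquiv.piFinSuccAbove]
    rfl
  have hint : Integrable (fun q : (E d × E d) × (Fin n → E d × E d) =>
      momentFun w ((MeasurableEquiv.piFinSuccAbove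
        (fun _ : Fin (n + 1) => E d × E d) 0).symm q))
      (γ.prod (Measure.pi fun _ : Fin n => γ)) := by
    refine (integrable_const (1 : ℝ)).mono'
      ((continuous_momentFun w).measurable.comp
        (MeasurableEquiv.measurable _)).aestronglyMeasurable (Eventually.of_forall fun q => ?_)
    rw [Real.norm_of_nonneg (momentFun_nonneg w _)]
    exact momentFun_le_one w _
  rw [integral_prod _ hint]
  refine integral_congr_ae (Eventually.of_forall fun p => ?_)
  simp only [hcoe, momentFun, Fin.cons_zero, Fin.cons_succ]
  rw [integral_const_mul]
  congr 1
  rw [integral_fin_nat_prod_eq_prod (μ := fun _ => γ)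
    (f := fun i (q : E d × E d) => statistic (w i) (q - (p.1, p.1)))]
  refine Finset.prod_congr rfl fun i _ => ?_
  rw [integral_shiftProd_neg _ _ _ (continuous_statistic (w i))]

/-- The law of the view from the first point of a pair drawn from `α ⊗ β`, weighted according to
the distance of the two points. -/
noncomputable def viewMeasure (α β : Measure (E d)) : Measure (Word → unitInterval) :=
  ((α.prod β).withDensity fun p => ENNReal.ofReal (weight (p.2 - p.1))).map
    fun p => view α β p.1

theorem measurable_weight_sub :
    Measurable fun p : E d × E d => ENNReal.ofReal (weight (p.2 - p.1)) := by
  have h := continuous_weight (V := E d)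
  exact (by fun_prop : Continuous fun p : E d × E d => weight (p.2 - p.1)).measurable.ennreal_ofReal

theorem measurable_view_fst (α β : Measure (E d)) [IsFiniteMeasure α] [IsFiniteMeasure β] :
    Measurable fun p : E d × E d => view α β p.1 :=
  (continuous_view α β).measurable.comp measurable_fst

/-- The total mass of `viewMeasure`. -/
noncomputable def viewMass (α β : Measure (E d)) : ENNReal :=
  ∫⁻ p, ENNReal.ofReal (weight (p.2 - p.1)) ∂(α.prod β)

theorem viewMeasure_univ (α β : Measure (E d)) [IsFiniteMeasure α] [IsFiniteMeasure β] :
    viewMeasure α β Set.univ = viewMass α β := by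
  rw [viewMeasure, Measure.map_apply (measurable_view_fst α β) MeasurableSet.univ,
    Set.preimage_univ, withDensity_apply _ MeasurableSet.univ, setLIntegral_univ, viewMass]

theorem viewMass_le (α β : Measure (E d)) [IsFiniteMeasure α] [IsFiniteMeasure β] :
    viewMass α β ≤ α Set.univ * β Set.univ := by
  rw [← Measure.prod_prod, Set.univ_prod_univ, ← lintegral_one]
  exact lintegral_mono fun p => ENNReal.ofReal_le_one.2 (weight_le_one _)

instance (α β : Measure (E d)) [IsFiniteMeasure α] [IsFiniteMeasure β] :
    IsFiniteMeasure (viewMeasure α β) :=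
  ⟨by
    rw [viewMeasure_univ]
    exact (viewMass_le α β).trans_lt (ENNReal.mul_lt_top (measure_lt_top _ _) (measure_lt_top _ _))⟩

theorem viewMass_ne_zero {α β : Measure (E d)} (h : α.prod β ≠ 0) : viewMass α β ≠ 0 := by
  rw [viewMass, Ne, lintegral_eq_zero_iff measurable_weight_sub]
  intro h0
  refine h (Measure.measure_univ_eq_zero.1 ?_)
  refine measure_mono_null (fun p _ => ?_) h0
  simpa using weight_pos (p.2 - p.1)

theorem viewMass_congr {α β α' β' : Measure (E d)} [IsFiniteMeasure α]
    [IsFiniteMeasure β] [IsFiniteMeasure α'] [IsFiniteMeasure β']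
    (h : diagOrbit α β = diagOrbit α' β') : viewMass α β = viewMass α' β' := by
  obtain ⟨x, hx⟩ : α'.prod β' ∈ diagOrbit α β := by
    rw [h]
    exact ⟨0, by simp only [translate_zero]⟩
  have hx' : shiftProd α β x = α'.prod β' := hx
  rw [viewMass, viewMass, ← hx', shiftProd_eq_map,
    lintegral_map measurable_weight_sub (measurable_add_const _)]
  simp

/-- The view measure of `α ⊗ β` is carried by the views of any product measure in the same orbit,
and gives no mass to the views of other product measures. -/
theorem viewMeasure_range_view {α β α' β' : Measure (E d)} [IsFiniteMeasure α]
    [IsFiniteMeasure β] [IsFiniteMeasure α'] [IsFiniteMeasure β']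
    (hα : α.real Set.univ ≤ 1) (hβ : β.real Set.univ ≤ 1) (hα' : α'.real Set.univ ≤ 1)
    (hβ' : β'.real Set.univ ≤ 1) [Decidable (diagOrbit α β = diagOrbit α' β')] :
    viewMeasure α β (Set.range (view α' β')) =
      if diagOrbit α β = diagOrbit α' β' then viewMass α' β' else 0 := by
  split_ifs with h
  · rw [← viewMass_congr h, ← viewMeasure_univ, viewMeasure,
      Measure.map_apply (measurable_view_fst α β) (measurableSet_range_view _ _),
      Measure.map_apply (measurable_view_fst α β) MeasurableSet.univ]
    congr 1
    rw [Set.preimage_univ]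
    exact Set.eq_univ_of_forall fun p => range_view_subset h ⟨p.1, rfl⟩
  · rw [viewMeasure, Measure.map_apply (measurable_view_fst α β) (measurableSet_range_view _ _)]
    have hempty : (fun p : E d × E d => view α β p.1) ⁻¹' Set.range (view α' β') = ∅ := by
      refine Set.eq_empty_of_forall_notMem fun p => ?_
      rintro ⟨x, hx⟩
      exact h (diagOrbit_eq_of_view_eq hα' hβ' hα hβ hx).symm
    rw [hempty, measure_empty]

theorem integral_viewMeasure {α β : Measure (E d)} [IsFiniteMeasure α] [IsFiniteMeasure β]
    (hα : α.real Set.univ ≤ 1) (hβ : β.real Set.univ ≤ 1) {n : ℕ} (w : Fin n → Word) :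
    ∫ u, ∏ i, (u (w i) : ℝ) ∂viewMeasure α β = pairIntegral (momentTest d w) α β := by
  have hc : Continuous fun u : Word → unitInterval => ∏ i, (u (w i) : ℝ) := by fun_prop
  rw [pairIntegral_momentTest, viewMeasure,
    integral_map (measurable_view_fst α β).aemeasurable hc.aestronglyMeasurable,
    integral_withDensity_eq_integral_toReal_smul measurable_weight_sub
      (Eventually.of_forall fun z => ENNReal.ofReal_lt_top)]
  refine integral_congr_ae (Eventually.of_forall fun p => ?_)
  simp only [ENNReal.toReal_ofReal (weight_pos _).le, smul_eq_mul, coe_view hα hβ]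

namespace PairFamily

theorem mass_α_le (F : PairFamily d) (i : ℕ) : (F.α i : Measure (E d)) Set.univ ≤ 1 :=
  (ENNReal.le_tsum i).trans F.sum_α

theorem mass_β_le (F : PairFamily d) (i : ℕ) : (F.β i : Measure (E d)) Set.univ ≤ 1 :=
  (ENNReal.le_tsum i).trans F.sum_β

theorem real_α_le (F : PairFamily d) (i : ℕ) : (F.α i : Measure (E d)).real Set.univ ≤ 1 :=
  ENNReal.toReal_le_of_le_ofReal zero_le_one (by simpa using F.mass_α_le i)

theorem real_β_le (F : PairFamily d) (i : ℕ) : (F.β i : Measure (E d)).real Set.univ ≤ 1 :=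
  ENNReal.toReal_le_of_le_ofReal zero_le_one (by simpa using F.mass_β_le i)

theorem summable_real_α (F : PairFamily d) :
    Summable fun i => (F.α i : Measure (E d)).real Set.univ :=
  ENNReal.summable_toReal (F.sum_α.trans_lt ENNReal.one_lt_top).ne

theorem summable_pairIntegral (F : PairFamily d) (f : TestFunction d) :
    Summable fun i => pairIntegral f (F.α i) (F.β i) :=
  Summable.of_norm_bounded (F.summable_real_α.mul_left ‖f.2.1‖) fun i =>
    abs_pairIntegral_le f _ _ (F.real_α_le i) (F.real_β_le i)

/-- The sum of the view measures of the members of a family. -/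
noncomputable def views (F : PairFamily d) : Measure (Word → unitInterval) :=
  Measure.sum fun i => viewMeasure (F.α i : Measure (E d)) (F.β i)

theorem views_univ_le (F : PairFamily d) : F.views Set.univ ≤ 1 := by
  rw [views, Measure.sum_apply _ MeasurableSet.univ]
  refine (ENNReal.tsum_le_tsum fun i => ?_).trans F.sum_α
  rw [viewMeasure_univ]
  exact (viewMass_le _ _).trans (mul_le_of_le_one_right' (F.mass_β_le i))

instance (F : PairFamily d) : IsFiniteMeasure F.views :=
  ⟨F.views_univ_le.trans_lt ENNReal.one_lt_top⟩

theorem views_eq_of_tsum_eq {F G : PairFamily d}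
    (h : ∀ f : TestFunction d, ∑' i, pairIntegral f (F.α i) (F.β i) =
      ∑' i, pairIntegral f (G.α i) (G.β i)) : F.views = G.views := by
  let c : Word → (Word → unitInterval) →ᵇ ℝ := fun w =>
    BoundedContinuousFunction.ofNormedAddCommGroup (fun u => (u w : ℝ)) (by fun_prop) 1 fun u => by
      rw [Real.norm_of_nonneg (u w).2.1]
      exact (u w).2.2
  refine ext_of_forall_integral_prod_eq c (fun u v huv => ?_) fun n w => ?_
  · obtain ⟨w, hw⟩ := Function.ne_iff.1 huv
    exact ⟨w, fun h => hw (Subtype.ext h)⟩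
  · have key : ∀ F : PairFamily d, ∫ u, ∏ i, c (w i) u ∂F.views =
        ∑' i, pairIntegral (momentTest d w) (F.α i) (F.β i) := by
      intro F
      have hint : Integrable (fun u => ∏ i, c (w i) u) F.views :=
        ((∏ i, c (w i)).integrable F.views).congr (Eventually.of_forall fun u => by simp)
      rw [views, integral_sum_measure hint]
      exact tsum_congr fun i => integral_viewMeasure (F.real_α_le i) (F.real_β_le i) w
    rw [key, key, h]

/-- The members of a family in a given nonzero orbit are counted by `views`. -/
theorem views_range_view (F : PairFamily d) {α β : Measure (E d)} [IsFiniteMeasure α]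
    [IsFiniteMeasure β] (hα : α.real Set.univ ≤ 1) (hβ : β.real Set.univ ≤ 1)
    (h0 : α.prod β ≠ 0) :
    F.views (Set.range (view α β)) =
      {i | F.prod i ≠ 0 ∧ F.orbit i = diagOrbit α β}.encard * viewMass α β := by
  classical
  rw [views, Measure.sum_apply _ (measurableSet_range_view _ _), ← ENNReal.tsum_set_const,
    tsum_subtype _ fun _ => viewMass α β]
  refine tsum_congr fun i => ?_
  rw [viewMeasure_range_view (F.real_α_le i) (F.real_β_le i) hα hβ, Set.indicator_apply]
  change (if F.orbit i = diagOrbit α β then _ else _) = _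
  by_cases h : F.orbit i = diagOrbit α β
  · have hne : F.prod i ≠ 0 := by
      intro hz
      have h1 := viewMass_congr h
      have h2 : viewMass (F.α i : Measure (E d)) (F.β i) = 0 := by
        have hz' : (F.α i : Measure (E d)).prod (F.β i : Measure (E d)) = 0 := hz
        rw [viewMass, hz', lintegral_zero_measure]
      exact viewMass_ne_zero h0 (h1.symm.trans h2)
    rw [if_pos h, if_pos ⟨hne, h⟩]
  · rw [if_neg h, if_neg fun hc => h hc.2]

/-- A collection is determined by the sums of the integrals of test functions. -/
theorem sameOrbits_of_tsum_eq {F G : PairFamily d}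
    (h : ∀ f : TestFunction d, ∑' i, pairIntegral f (F.α i) (F.β i) =
      ∑' i, pairIntegral f (G.α i) (G.β i)) : F.SameOrbits G := by
  have hviews := views_eq_of_tsum_eq h
  -- each nonzero orbit occurs equally often, and finitely often, in both families
  have hcard : ∀ {α β : Measure (E d)} [IsFiniteMeasure α] [IsFiniteMeasure β],
      α.real Set.univ ≤ 1 → β.real Set.univ ≤ 1 → α.prod β ≠ 0 →
      {i | F.prod i ≠ 0 ∧ F.orbit i = diagOrbit α β}.encard =
        {i | G.prod i ≠ 0 ∧ G.orbit i = diagOrbit α β}.encard ∧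
      {i | F.prod i ≠ 0 ∧ F.orbit i = diagOrbit α β}.Finite := by
    intro α β _ _ hα hβ h0
    have h1 := F.views_range_view hα hβ h0
    have h2 := G.views_range_view hα hβ h0
    have hm0 := viewMass_ne_zero h0
    have hmtop : viewMass α β ≠ ⊤ := ((viewMass_le α β).trans_lt
      (ENNReal.mul_lt_top (measure_lt_top _ _) (measure_lt_top _ _))).ne
    constructor
    · rw [hviews, h2, ENNReal.mul_left_inj hm0 hmtop] at h1
      exact_mod_cast h1.symm
    · rw [← Set.encard_lt_top_iff, ← ENat.toENNReal_lt_top]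
      have := (h1.symm.le.trans (measure_mono (Set.subset_univ _))).trans F.views_univ_le
      by_contra hcon
      rw [not_lt_top_iff] at hcon
      rw [hcon, ENNReal.top_mul hm0] at this
      exact absurd this (by simp)
  have hequiv : ∀ o : Set (Measure (E d × E d)),
      Nonempty ({x : {i // F.prod i ≠ 0} // F.orbit x = o} ≃
        {x : {i // G.prod i ≠ 0} // G.orbit x = o}) := by
    intro o
    by_cases ho : ∃ (α β : FiniteMeasure (E d)), (α : Measure (E d)).real Set.univ ≤ 1 ∧
        (β : Measure (E d)).real Set.univ ≤ 1 ∧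
        (α : Measure (E d)).prod (β : Measure (E d)) ≠ 0 ∧
        o = diagOrbit (α : Measure (E d)) β
    · obtain ⟨α, β, hα, hβ, h0, rfl⟩ := ho
      obtain ⟨h1, h2⟩ := hcard hα hβ h0
      have h3 := h2
      rw [← Set.encard_lt_top_iff, h1, Set.encard_lt_top_iff] at h3
      have e : ∀ H : PairFamily d, {x : {i // H.prod i ≠ 0} // H.orbit x = diagOrbit
          (α : Measure (E d)) β} ≃
          {i | H.prod i ≠ 0 ∧ H.orbit i = diagOrbit (α : Measure (E d)) β} := fun H =>
        Equiv.subtypeSubtypeEquivSubtypeInter (fun i => H.prod i ≠ 0)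
          (fun i => H.orbit i = diagOrbit (α : Measure (E d)) β)
      have := h2.to_subtype
      have := h3.to_subtype
      have hc : Nat.card {i | F.prod i ≠ 0 ∧ F.orbit i = diagOrbit (α : Measure (E d)) β} =
          Nat.card {i | G.prod i ≠ 0 ∧ G.orbit i = diagOrbit (α : Measure (E d)) β} := by
        rw [Nat.card_coe_set_eq, Nat.card_coe_set_eq, Set.ncard_def, Set.ncard_def, h1]
      exact ⟨(e F).trans ((Finite.card_eq.1 hc).some.trans (e G).symm)⟩
    · have hemp : ∀ H : PairFamily d, IsEmpty {x : {i // H.prod i ≠ 0} // H.orbit x = o} :=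
        fun H => ⟨fun x => ho ⟨H.α x.1, H.β x.1, H.real_α_le _, H.real_β_le _, x.1.2, x.2.symm⟩⟩
      have := hemp F
      have := hemp G
      exact ⟨Equiv.equivOfIsEmpty _ _⟩
  let e := (Equiv.sigmaFiberEquiv fun x : {i // F.prod i ≠ 0} => F.orbit x).symm.trans
    ((Equiv.sigmaCongrRight fun o => (hequiv o).some).trans
      (Equiv.sigmaFiberEquiv fun x : {i // G.prod i ≠ 0} => G.orbit x))
  exact ⟨e, fun i => ((hequiv (F.orbit i)).some ⟨i, rfl⟩).2⟩

end PairFamily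

/-! ### Density of the orbits of products of probability measures -/

theorem tendsto_integral_add_cobounded (α : Measure (E d)) [IsFiniteMeasure α] {g : E d → ℝ}
    (hg : Continuous g) (hgc : HasCompactSupport g) {l : Filter ι} {v : ι → E d}
    (hv : Tendsto (fun i => ‖v i‖) l atTop) :
    Tendsto (fun i => ∫ x, g (x + v i) ∂α) l (𝓝 0) := by
  obtain ⟨C, hC⟩ := hg.bounded_above_of_compact_support hgc
  have : (Bornology.cobounded (E d)).IsCountablyGenerated := by
    rw [← comap_norm_atTop]
    infer_instance
  have h : Tendsto (fun v : E d => ∫ x, g (x + v) ∂α) (Bornology.cobounded (E d))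
      (𝓝 (∫ _, (0 : ℝ) ∂α)) := by
    refine tendsto_integral_filter_of_dominated_convergence (fun _ => C)
      (Eventually.of_forall fun v =>
        (by fun_prop : Continuous _).aestronglyMeasurable)
      (Eventually.of_forall fun v => Eventually.of_forall fun x => hC _) (integrable_const _)
      (Eventually.of_forall fun x => ?_)
    refine (hgc.is_zero_at_infty.mono_left Metric.cobounded_eq_cocompact.le).comp ?_
    rw [← tendsto_norm_atTop_iff_cobounded]
    refine tendsto_atTop_mono (fun v => ?_)
      (tendsto_atTop_add_const_right _ (-‖x‖) tendsto_norm_cobounded_atTop)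
    have := norm_sub_le (x + v) x
    rw [add_sub_cancel_left] at this
    linarith
  rw [integral_zero] at h
  exact h.comp (tendsto_norm_atTop_iff_cobounded.1 hv)

theorem eq_zero_of_forall_integral_eq_zero {α : FiniteMeasure (E d)}
    (h : ∀ g : E d → ℝ, Continuous g → HasCompactSupport g → ∫ x, g x ∂(α : Measure (E d)) = 0) :
    α = 0 := by
  have h1 := tendsto_integral_cut (α : Measure (E d))
  simp only [h _ (continuous_cut _) (hasCompactSupport_cut _)] at h1
  have h2 := tendsto_nhds_unique h1 tendsto_const_nhds
  rw [measureReal_eq_zero_iff (measure_ne_top _ _), Measure.measure_univ_eq_zero] at h2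
  exact Subtype.ext h2

/-- If distances are not eventually bounded along an ultrafilter, they tend to infinity. -/
theorem tendsto_norm_atTop_of_not_bounded {𝒰 : Ultrafilter ι} {v : ι → E d}
    (h : ¬ ∃ T : ℝ, ∀ᶠ i in 𝒰, ‖v i‖ ≤ T) : Tendsto (fun i => ‖v i‖) 𝒰 atTop := by
  rw [tendsto_atTop]
  intro T
  by_contra hcon
  rw [← Ultrafilter.eventually_not] at hcon
  exact h ⟨T, hcon.mono fun i hi => (not_le.1 hi).le⟩

/-- The superposition of the measures `α k`, translated by `b k`. -/
noncomputable def superpose (α : ℕ → FiniteMeasure (E d)) (b : ℕ → E d) : Measure (E d) :=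
  Measure.sum fun k => translate (α k) (b k)

theorem superpose_univ (α : ℕ → FiniteMeasure (E d)) (b : ℕ → E d) :
    superpose α b Set.univ = ∑' k, (α k : Measure (E d)) Set.univ := by
  rw [superpose, Measure.sum_apply _ MeasurableSet.univ]
  simp only [translate_univ]

/-- Superpositions along diverging centres, seen from moving points `c i`, converge vaguely, member
by member. -/
theorem tendsto_integral_superpose {α : ℕ → FiniteMeasure (E d)}
    (hα : ∑' k, (α k : Measure (E d)) Set.univ ≤ 1) {l : Filter ι} {a : ℕ → ι → E d} {c : ι → E d}
    {g : E d → ℝ} (hg : Continuous g) (hgc : HasCompactSupport g) {L : ℕ → ℝ}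
    (hL : ∀ k, Tendsto (fun i => ∫ x, g (x + (a k i - c i)) ∂(α k : Measure (E d))) l (𝓝 (L k))) :
    Tendsto (fun i => ∫ x, g x ∂translate (superpose α fun k => a k i) (-c i)) l
      (𝓝 (∑' k, L k)) := by
  obtain ⟨C, hC⟩ := hg.bounded_above_of_compact_support hgc
  have hsum : Summable fun k => (α k : Measure (E d)).real Set.univ :=
    ENNReal.summable_toReal (hα.trans_lt ENNReal.one_lt_top).ne
  refine (tendsto_tsum_of_dominated_convergence (hsum.mul_left C) hL
    (Eventually.of_forall fun i k => ?_)).congr fun i => ?_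
  · exact norm_integral_le_of_norm_le_const (Eventually.of_forall fun x => hC _)
  · have : IsFiniteMeasure (superpose α fun k => a k i) :=
      ⟨by rw [superpose_univ]; exact hα.trans_lt ENNReal.one_lt_top⟩
    rw [integral_translate_neg _ _ hg]
    have hint : Integrable (fun x => g (x - c i)) (superpose α fun k => a k i) :=
      (integrable_const C).mono' (by fun_prop : Continuous _).aestronglyMeasurable
        (Eventually.of_forall fun x => hC _)
    rw [superpose] at hint ⊢
    rw [integral_sum_measure hint]
    refine tsum_congr fun k => ?_
    rw [integral_translate _ _ (by fun_prop : Continuous fun x => g (x - c i))]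
    simp only [add_sub_assoc]

/-- Superposing the members of a family along diverging centres gives measures whose profiles are
the members of the family. -/
theorem isProfile_superpose {𝒰 : Ultrafilter ι} (F : PairFamily d) {a : ℕ → ι → E d}
    (ha : ∀ j j', j ≠ j' → Tendsto (fun i => ‖a j i - a j' i‖) 𝒰 atTop)
    {μ ν : ι → ProbabilityMeasure (E d)}
    (hμ : ∀ i, (μ i : Measure (E d)) = superpose F.α fun k => a k i)
    (hν : ∀ i, (ν i : Measure (E d)) = superpose F.β fun k => a k i) :
    IsProfile 𝒰 μ ν F.α F.β a := by
  have hvague : ∀ α : ℕ → FiniteMeasure (E d), ∑' k, (α k : Measure (E d)) Set.univ ≤ 1 →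
      ∀ j, VagueLim 𝒰 (fun i => translate (superpose α fun k => a k i) (-a j i)) (α j) := by
    intro α hα j g hg hgc
    have := tendsto_integral_superpose hα (l := (𝒰 : Filter ι)) (a := a) (c := a j) hg hgc
      (L := fun k => if k = j then ∫ x, g x ∂(α j : Measure (E d)) else 0) fun k => by
        by_cases hk : k = j
        · subst hk
          simp
        · simpa only [if_neg hk] using tendsto_integral_add_cobounded _ hg hgc (ha k j hk)
    simpa using this
  refine
    { vague_left := fun j => ?_
      vague_right := fun j => ?_
      separated := ha
      maximal := ?_ }
  · simp only [hμ]
    exact hvague F.α F.sum_α j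
  · simp only [hν]
    exact hvague F.β F.sum_β j
  · intro b α' _ hα' _ h0 _
    by_contra hcon
    push Not at hcon
    refine h0 (eq_zero_of_forall_integral_eq_zero fun g hg hgc => ?_)
    refine tendsto_nhds_unique (hα' g hg hgc) ?_
    simp only [hμ]
    have := tendsto_integral_superpose F.sum_α (l := (𝒰 : Filter ι)) (a := a) (c := b) hg hgc
      (L := fun _ => 0) fun k => tendsto_integral_add_cobounded _ hg hgc <| by
        simp only [norm_sub_rev (a k _)]
        exact tendsto_atTop.2 fun T => (hcon k T).mono fun _ h => h.le
    simpa using this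

namespace PairFamily

/-- The missing mass of a sequence of measures, placed at the origin. -/
noncomputable def defect (α : ℕ → FiniteMeasure (E d)) : FiniteMeasure (E d) :=
  ⟨(1 - ∑' i, (α i : Measure (E d)) Set.univ) • Measure.dirac 0,
    ⟨by
      rw [Measure.smul_apply, smul_eq_mul]
      exact ENNReal.mul_lt_top (tsub_le_self.trans_lt ENNReal.one_lt_top) (measure_lt_top _ _)⟩⟩

theorem defect_univ (α : ℕ → FiniteMeasure (E d)) :
    (defect α : Measure (E d)) Set.univ = 1 - ∑' i, (α i : Measure (E d)) Set.univ := by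
  change ((1 - ∑' i, (α i : Measure (E d)) Set.univ) • Measure.dirac (0 : E d)) Set.univ = _
  rw [Measure.smul_apply, smul_eq_mul, measure_univ, mul_one]

/-- The sequence `x, y, α 0, α 1, …`. -/
def cons₂ {A : Type*} (x y : A) (α : ℕ → A) : ℕ → A
  | 0 => x
  | 1 => y
  | n + 2 => α n

theorem tsum_cons₂ (x y : FiniteMeasure (E d)) (α : ℕ → FiniteMeasure (E d)) :
    ∑' i, ((cons₂ x y α i : FiniteMeasure (E d)) : Measure (E d)) Set.univ =
      (x : Measure (E d)) Set.univ + (y : Measure (E d)) Set.univ +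
        ∑' i, (α i : Measure (E d)) Set.univ := by
  rw [← ENNReal.summable.sum_add_tsum_nat_add' (k := 2)]
  simp [Finset.sum_range_succ, cons₂]

theorem tsum_completed_α (F : PairFamily d) :
    ∑' i, ((cons₂ (defect F.α) 0 F.α i : FiniteMeasure (E d)) : Measure (E d)) Set.univ = 1 := by
  rw [tsum_cons₂, defect_univ]
  simpa using tsub_add_cancel_of_le F.sum_α

theorem tsum_completed_β (F : PairFamily d) :
    ∑' i, ((cons₂ 0 (defect F.β) F.β i : FiniteMeasure (E d)) : Measure (E d)) Set.univ = 1 := by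
  rw [tsum_cons₂, defect_univ]
  simpa using tsub_add_cancel_of_le F.sum_β

/-- The same collection with the missing masses of both sequences added as two further members
whose product is zero. -/
noncomputable def completed (F : PairFamily d) : PairFamily d where
  α := cons₂ (defect F.α) 0 F.α
  β := cons₂ 0 (defect F.β) F.β
  sum_α := F.tsum_completed_α.le
  sum_β := F.tsum_completed_β.le

theorem tsum_pairIntegral_completed (F : PairFamily d) (f : TestFunction d) :
    ∑' i, pairIntegral f (F.completed.α i) (F.completed.β i) =
      ∑' i, pairIntegral f (F.α i) (F.β i) := by
  rw [← (F.completed.summable_pairIntegral f).sum_add_tsum_nat_add 2]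
  have h0 : pairIntegral f (F.completed.α 0) (F.completed.β 0) = 0 :=
    pairIntegral_eq_zero f _ _ (by simp [completed, cons₂])
  have h1 : pairIntegral f (F.completed.α 1) (F.completed.β 1) = 0 :=
    pairIntegral_eq_zero f _ _ (by simp [completed, cons₂])
  rw [Finset.sum_range_succ, Finset.sum_range_one, h0, h1, add_zero, zero_add]
  rfl

end PairFamily

/-- Every collection is a limit of products of probability measures. -/
theorem exists_tendsto_pairIntegral (hd : 1 ≤ d) (F : PairFamily d) :
    ∃ μ ν : ℕ → ProbabilityMeasure (E d), ∀ f : TestFunction d,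
      Tendsto (fun t => pairIntegral f (μ t) (ν t)) (hyperfilter ℕ)
        (𝓝 (∑' i, pairIntegral f (F.α i) (F.β i))) := by
  let e : E d := EuclideanSpace.single ⟨0, hd⟩ 1
  have he : ‖e‖ = 1 := by simp [e]
  let a : ℕ → ℕ → E d := fun k t => ((t : ℝ) * k) • e
  have ha : ∀ j j', j ≠ j' → Tendsto (fun t => ‖a j t - a j' t‖) (hyperfilter ℕ : Filter ℕ)
      atTop := by
    intro j j' hne
    have h : ∀ t, ‖a j t - a j' t‖ = (t : ℝ) * |(j : ℝ) - j'| := by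
      intro t
      simp only [a]
      rw [← sub_smul, norm_smul, he, mul_one, ← mul_sub, norm_mul, Real.norm_eq_abs,
        Real.norm_eq_abs, Nat.abs_cast]
    simp only [h]
    refine Tendsto.mono_left ?_ Nat.hyperfilter_le_atTop
    refine tendsto_natCast_atTop_atTop.atTop_mul_const (abs_pos.2 (sub_ne_zero.2 ?_))
    exact_mod_cast hne
  let μ : ℕ → ProbabilityMeasure (E d) := fun t => ⟨superpose F.completed.α fun k => a k t,
    ⟨by rw [superpose_univ]; exact F.tsum_completed_α⟩⟩
  let ν : ℕ → ProbabilityMeasure (E d) := fun t => ⟨superpose F.completed.β fun k => a k t,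
    ⟨by rw [superpose_univ]; exact F.tsum_completed_β⟩⟩
  refine ⟨μ, ν, fun f => ?_⟩
  rw [← F.tsum_pairIntegral_completed f]
  exact (isProfile_superpose F.completed ha (fun _ => rfl) (fun _ => rfl)).tendsto_pairIntegral f

/-! ### Weak continuity of the integrals of test functions -/

/-- Weakly convergent pairs of probability measures have a single profile, without recentring. -/
theorem isProfile_of_tendsto {𝒰 : Ultrafilter ι} {μ ν : ι → ProbabilityMeasure (E d)}
    {μ₀ ν₀ : ProbabilityMeasure (E d)} (hμ : Tendsto μ 𝒰 (𝓝 μ₀)) (hν : Tendsto ν 𝒰 (𝓝 ν₀)) :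
    IsProfile 𝒰 μ ν (fun _ : Unit => μ₀.toFiniteMeasure) (fun _ => ν₀.toFiniteMeasure)
      (fun _ _ => 0) := by
  have hvague : ∀ (μ : ι → ProbabilityMeasure (E d)) (μ₀ : ProbabilityMeasure (E d)),
      Tendsto μ 𝒰 (𝓝 μ₀) → VagueLim 𝒰 (fun i => (μ i : Measure (E d))) μ₀ := by
    intro μ μ₀ hμ g hg hgc
    obtain ⟨C, hC⟩ := hg.bounded_above_of_compact_support hgc
    exact (ProbabilityMeasure.tendsto_iff_forall_integral_tendsto.1 hμ)
      (BoundedContinuousFunction.ofNormedAddCommGroup g hg C hC)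
  refine
    { vague_left := fun _ => by
        simp only [neg_zero, translate_zero]
        exact hvague μ μ₀ hμ
      vague_right := fun _ => by
        simp only [neg_zero, translate_zero]
        exact hvague ν ν₀ hν
      separated := fun j j' h => absurd (Subsingleton.elim j j') h
      maximal := ?_ }
  intro b α' _ hα' _ h0 _
  refine ⟨(), ?_⟩
  by_contra hcon
  simp only [sub_zero] at hcon
  have hb := tendsto_norm_atTop_of_not_bounded hcon
  have hpos := measureReal_univ_pos h0
  obtain ⟨R, hR⟩ :=
    ((tendsto_integral_cut (α' : Measure (E d))).eventually_const_lt hpos).exists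
  have hlim := (tendsto_integral_cut (μ₀ : Measure (E d))).const_sub 1
  rw [probReal_univ, sub_self] at hlim
  obtain ⟨R', hR'⟩ := (hlim.eventually_lt_const hR).exists
  refine (le_of_tendsto_of_tendsto (hα' _ (continuous_cut R) (hasCompactSupport_cut _))
    ((hvague μ μ₀ hμ _ (continuous_cut R') (hasCompactSupport_cut _)).const_sub 1) ?_).not_gt hR'
  filter_upwards [hb.eventually_ge_atTop (R + 1 + (R' + 1))] with i hi
  rw [integral_translate_neg _ _ (continuous_cut R)]
  have hc := continuous_cut (d := d) R
  have hint : Integrable (fun x => cut R (x - b i)) (μ i : Measure (E d)) :=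
    (integrable_const (1 : ℝ)).mono' (by fun_prop : Continuous _).aestronglyMeasurable
      (Eventually.of_forall fun x => abs_cut_le_one _ _)
  have h1 : 1 - ∫ x, cut R' x ∂(μ i : Measure (E d)) =
      ∫ x, (1 - cut R' x) ∂(μ i : Measure (E d)) := by
    rw [integral_sub (integrable_const _) (integrable_cut _ _)]
    simp
  rw [h1]
  refine integral_mono hint ((integrable_const _).sub (integrable_cut _ _)) fun x => ?_
  by_cases hx : R' + 1 ≤ ‖x‖
  · simp only [cut_eq_zero hx, sub_zero]
    exact cut_le_one _ _
  · have h2 := norm_sub_le x (x - b i)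
    rw [sub_sub_cancel] at h2
    simp only [cut_eq_zero (R := R) (x := x - b i) (by linarith)]
    exact sub_nonneg.2 (cut_le_one _ _)

theorem tendsto_pairIntegral_of_tendsto {𝒰 : Ultrafilter ι} {μ ν : ι → ProbabilityMeasure (E d)}
    {μ₀ ν₀ : ProbabilityMeasure (E d)} (hμ : Tendsto μ 𝒰 (𝓝 μ₀)) (hν : Tendsto ν 𝒰 (𝓝 ν₀))
    (f : TestFunction d) :
    Tendsto (fun i => pairIntegral f (μ i) (ν i)) 𝒰 (𝓝 (pairIntegral f μ₀ ν₀)) := by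
  simpa using (isProfile_of_tendsto hμ hν).tendsto_pairIntegral f

/-! ### The metric -/

/-- The collection of the orbits of a family. -/
def X.mk (F : PairFamily d) : X d := Quotient.mk (PairFamily.setoid d) F

theorem X.exists_mk (ξ : X d) : ∃ F, X.mk F = ξ := Quotient.exists_rep ξ

theorem Lam_mk (f : TestFunction d) (F : PairFamily d) :
    Lam f (X.mk F) = ∑' i, pairIntegral f (F.α i) (F.β i) := rfl

theorem Lam_ofOrbit_mk (f : TestFunction d) (μ ν : ProbabilityMeasure (E d)) :
    Lam f (ofOrbit (Quotient.mk _ (μ, ν))) = pairIntegral f μ ν := by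
  change ∑' i, pairIntegral f ((PairFamily.single μ ν).α i) ((PairFamily.single μ ν).β i) = _
  rw [tsum_eq_single 0 fun i hi => pairIntegral_eq_zero f _ _ (by simp [PairFamily.single, hi])]
  simp [PairFamily.single]

theorem Lam_ofOrbit (f : TestFunction d) (q : ProductOrbit d) :
    Lam f (ofOrbit q) = pairIntegral f q.out.1 q.out.2 := by
  rw [← Lam_ofOrbit_mk, Prod.mk.eta, Quotient.out_eq]

theorem tsum_real_α_le (F : PairFamily d) :
    ∑' i, (F.α i : Measure (E d)).real Set.univ ≤ 1 := by
  simp only [measureReal_def]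
  rw [← ENNReal.tsum_toReal_eq fun i => measure_ne_top _ _]
  exact ENNReal.toReal_le_of_le_ofReal zero_le_one (by simpa using F.sum_α)

/-- A bound on the sum of integrals of one function, uniform over all collections. -/
theorem abs_tsum_integral_pi_le {k : ℕ} (hk : 0 < k) (g : (Fin k → E d × E d) →ᵇ ℝ)
    (F : PairFamily d) :
    |∑' i, ∫ z, g z ∂(Measure.pi fun _ => (F.α i : Measure (E d)).prod (F.β i : Measure (E d)))| ≤
      ‖g‖ := by
  have h := tsum_of_norm_bounded (F.summable_real_α.mul_left ‖g‖).hasSum (f := fun i =>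
      ∫ z, g z ∂(Measure.pi fun _ => (F.α i : Measure (E d)).prod (F.β i : Measure (E d)))) fun i =>
    abs_integral_pi_le hk g (F.α i : Measure (E d)) (F.β i) (F.real_α_le i) (F.real_β_le i)
  rw [tsum_mul_left] at h
  exact h.trans (mul_le_of_le_one_right (norm_nonneg _) (tsum_real_α_le F))

theorem abs_Lam_le (f : TestFunction d) (ξ : X d) : |Lam f ξ| ≤ ‖f.2.1‖ := by
  obtain ⟨F, rfl⟩ := ξ.exists_mk
  exact abs_tsum_integral_pi_le f.1.pos f.2.1 F

theorem continuous_Lam (ξ : X d) : Continuous fun f : TestFunction d => Lam f ξ := by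
  obtain ⟨F, rfl⟩ := ξ.exists_mk
  refine continuous_sigma fun k => ?_
  refine LipschitzWith.continuous (K := 1) (LipschitzWith.of_dist_le_mul fun g g' => ?_)
  rw [NNReal.coe_one, one_mul, Subtype.dist_eq, dist_eq_norm g.1 g'.1, Real.dist_eq, Lam_mk,
    Lam_mk, ← (F.summable_pairIntegral ⟨k, g⟩).tsum_sub (F.summable_pairIntegral ⟨k, g'⟩)]
  refine le_of_eq_of_le (congrArg _ (tsum_congr fun i => ?_))
    (abs_tsum_integral_pi_le k.pos (g.1 - g'.1) F)
  exact (integral_sub (g.1.integrable _) (g'.1.integrable _)).symm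

/-- A dense sequence of test functions separates collections. -/
theorem eq_of_Lam_eq {f : ℕ → TestFunction d} (hf : DenseRange f) {ξ₁ ξ₂ : X d}
    (h : ∀ r, Lam (f r) ξ₁ = Lam (f r) ξ₂) : ξ₁ = ξ₂ := by
  have hall : (fun g => Lam g ξ₁) = fun g => Lam g ξ₂ :=
    hf.equalizer (continuous_Lam ξ₁) (continuous_Lam ξ₂) (funext h)
  obtain ⟨F, rfl⟩ := ξ₁.exists_mk
  obtain ⟨G, rfl⟩ := ξ₂.exists_mk
  exact Quotient.sound (PairFamily.sameOrbits_of_tsum_eq fun g => congrFun hall g)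

/-- The `r`-th term of the series defining `D`. -/
noncomputable def termD (f : ℕ → TestFunction d) (ξ₁ ξ₂ : X d) (r : ℕ) : ℝ :=
  1 / 2 ^ (r + 1) * (1 / (1 + ‖((f r).2 : (Fin ((f r).1 : ℕ) → E d × E d) →ᵇ ℝ)‖)) *
    |Lam (f r) ξ₁ - Lam (f r) ξ₂|

theorem termD_nonneg (f : ℕ → TestFunction d) (ξ₁ ξ₂ : X d) (r : ℕ) : 0 ≤ termD f ξ₁ ξ₂ r := by
  unfold termD
  positivity

theorem termD_le (f : ℕ → TestFunction d) (ξ₁ ξ₂ : X d) (r : ℕ) :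
    termD f ξ₁ ξ₂ r ≤ (1 / 2) ^ r := by
  have h1 := abs_Lam_le (f r) ξ₁
  have h2 := abs_Lam_le (f r) ξ₂
  have h3 := abs_sub (Lam (f r) ξ₁) (Lam (f r) ξ₂)
  have h4 : 0 < 1 + ‖(f r).2.1‖ := by positivity
  have h5 : 1 / (1 + ‖(f r).2.1‖) * |Lam (f r) ξ₁ - Lam (f r) ξ₂| ≤ 2 := by
    rw [one_div, inv_mul_le_iff₀ h4]
    linarith
  calc termD f ξ₁ ξ₂ r
      = 1 / 2 ^ (r + 1) * (1 / (1 + ‖(f r).2.1‖) * |Lam (f r) ξ₁ - Lam (f r) ξ₂|) := by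
        unfold termD; ring
    _ ≤ 1 / 2 ^ (r + 1) * 2 := mul_le_mul_of_nonneg_left h5 (by positivity)
    _ = (1 / 2) ^ r := by rw [pow_succ, one_div_pow]; field_simp

theorem summable_termD (f : ℕ → TestFunction d) (ξ₁ ξ₂ : X d) : Summable (termD f ξ₁ ξ₂) :=
  Summable.of_nonneg_of_le (termD_nonneg f ξ₁ ξ₂) (termD_le f ξ₁ ξ₂) summable_geometric_two

theorem termD_triangle (f : ℕ → TestFunction d) (ξ₁ ξ₂ ξ₃ : X d) (r : ℕ) :
    termD f ξ₁ ξ₃ r ≤ termD f ξ₁ ξ₂ r + termD f ξ₂ ξ₃ r := by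
  unfold termD
  rw [← mul_add]
  exact mul_le_mul_of_nonneg_left (abs_sub_le _ _ _) (by positivity)

/-- The metric space structure given by `D`. -/
@[reducible]
noncomputable def metricSpaceX (f : ℕ → TestFunction d) (hf : DenseRange f) :
    MetricSpace (X d) where
  dist := D f
  dist_self ξ := by simp [D]
  dist_comm ξ₁ ξ₂ := by simp only [D, abs_sub_comm]
  dist_triangle ξ₁ ξ₂ ξ₃ := by
    change ∑' r, termD f ξ₁ ξ₃ r ≤ (∑' r, termD f ξ₁ ξ₂ r) + ∑' r, termD f ξ₂ ξ₃ r
    rw [← (summable_termD f ξ₁ ξ₂).tsum_add (summable_termD f ξ₂ ξ₃)]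
    exact (summable_termD f ξ₁ ξ₃).tsum_le_tsum (termD_triangle f ξ₁ ξ₂ ξ₃)
      ((summable_termD f ξ₁ ξ₂).add (summable_termD f ξ₂ ξ₃))
  eq_of_dist_eq_zero := by
    intro ξ₁ ξ₂ h
    change ∑' r, termD f ξ₁ ξ₂ r = 0 at h
    refine eq_of_Lam_eq hf fun r => ?_
    have h0 : termD f ξ₁ ξ₂ r = 0 :=
      congrFun ((hasSum_zero_iff_of_nonneg (termD_nonneg f ξ₁ ξ₂)).1
        (h ▸ (summable_termD f ξ₁ ξ₂).hasSum)) r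
    unfold termD at h0
    have h1 : (1 : ℝ) / 2 ^ (r + 1) * (1 / (1 + ‖(f r).2.1‖)) ≠ 0 := by positivity
    simpa [sub_eq_zero] using (mul_eq_zero.1 h0).resolve_left h1

/-- Convergence for `D` is convergence of the functionals `Lam (f r)`. -/
theorem tendsto_iff_forall_tendsto_Lam {f : ℕ → TestFunction d} (hf : DenseRange f) {l : Filter ι}
    {x : ι → X d} {ξ : X d} :
    Tendsto x l (@nhds _ (metricSpaceX f hf).toUniformSpace.toTopologicalSpace ξ) ↔
      ∀ r, Tendsto (fun i => Lam (f r) (x i)) l (𝓝 (Lam (f r) ξ)) := by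
  let _ := metricSpaceX f hf
  rw [tendsto_iff_dist_tendsto_zero]
  constructor
  · intro h r
    rw [tendsto_iff_dist_tendsto_zero]
    have hpos : (0 : ℝ) < 1 / 2 ^ (r + 1) * (1 / (1 + ‖(f r).2.1‖)) := by positivity
    have h1 := h.const_mul (1 / 2 ^ (r + 1) * (1 / (1 + ‖(f r).2.1‖)))⁻¹
    rw [mul_zero] at h1
    refine squeeze_zero (fun _ => dist_nonneg) (fun i => ?_) h1
    rw [Real.dist_eq, le_inv_mul_iff₀ hpos]
    exact (summable_termD f (x i) ξ).le_tsum r fun j _ => termD_nonneg f _ _ j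
  · intro h
    have h1 := tendsto_tsum_of_dominated_convergence (𝓕 := l) (f := fun i => termD f (x i) ξ)
      (g := fun _ => 0) summable_geometric_two (fun r => ?_) (Eventually.of_forall fun i r => ?_)
    · rw [tsum_zero] at h1
      exact h1
    · have h2 := ((h r).sub_const (Lam (f r) ξ)).abs.const_mul
        (1 / 2 ^ (r + 1) * (1 / (1 + ‖(f r).2.1‖)))
      rw [sub_self, abs_zero, mul_zero] at h2
      exact h2
    · rw [Real.norm_of_nonneg (termD_nonneg _ _ _ _)]
      exact termD_le _ _ _ _

/-! ### The embedding of the orbits of products of probability measures -/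

/-- Along an ultrafilter, orbits of products of probability measures converge to a collection. -/
theorem exists_tendsto_Lam (𝒰 : Ultrafilter ι) (p : ι → ProductOrbit d) :
    ∃ F : PairFamily d,
      (∀ f : TestFunction d, Tendsto (fun i => Lam f (ofOrbit (p i))) 𝒰
        (𝓝 (Lam f (X.mk F)))) ∧
      ∀ n, F.prod n ≠ 0 → ∃ a : ι → E d,
        VagueLim 𝒰 (fun i => translate ((p i).out.1) (-a i)) (F.α n) ∧
        VagueLim 𝒰 (fun i => translate ((p i).out.2) (-a i)) (F.β n) := by
  obtain ⟨F, h1, h2⟩ := exists_limit_family 𝒰 (fun i => (p i).out.1) (fun i => (p i).out.2)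
  exact ⟨F, fun f => by simpa only [Lam_ofOrbit, Lam_mk] using h1 f, h2⟩

theorem diagOrbit_translate (α β : Measure (E d)) [IsFiniteMeasure α] [IsFiniteMeasure β]
    (x : E d) : diagOrbit (translate α x) (translate β x) = diagOrbit α β := by
  refine diagOrbit_eq_of_shiftProd_eq (x := 0) (x' := x) ?_
  rw [shiftProd, translate_zero, translate_zero]
  rfl

/-- The translates of a probability measure. -/
noncomputable def translateProb (μ : ProbabilityMeasure (E d)) (x : E d) :
    ProbabilityMeasure (E d) := ⟨translate μ x, inferInstance⟩

theorem mk_translateProb (q : ProductOrbit d) (x : E d) :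
    (Quotient.mk _ (translateProb q.out.1 x, translateProb q.out.2 x) : ProductOrbit d) = q := by
  conv_rhs => rw [← Quotient.out_eq q]
  exact Quotient.sound (diagOrbit_translate (q.out.1 : Measure (E d)) q.out.2 x)

theorem univ_mul_univ_of_diagOrbit_eq {α β α' β' : Measure (E d)} [IsFiniteMeasure α]
    [IsFiniteMeasure β] [IsFiniteMeasure α'] [IsFiniteMeasure β']
    (h : diagOrbit α β = diagOrbit α' β') :
    α Set.univ * β Set.univ = α' Set.univ * β' Set.univ := by
  obtain ⟨x, hx⟩ := h ▸ shiftProd_mem_diagOrbit α β 0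
  have h1 := congrArg (fun m : Measure (E d × E d) => m (Set.univ ×ˢ Set.univ)) hx
  simpa only [shiftProd, Measure.prod_prod, translate_univ] using h1.symm

/-- An ultrafilter of orbits that converges to the orbit `q` of a product of probability measures
in the sense of test functions converges to `q` in the quotient of the weak topologies: the limit
collection has the single member `q`, so recentred measures converge vaguely without loss of mass,
hence weakly. -/
theorem le_nhds_of_tendsto_Lam {f : ℕ → TestFunction d} (hf : DenseRange f)
    (𝒰 : Ultrafilter (ProductOrbit d)) (q : ProductOrbit d)
    (h : ∀ r, Tendsto (fun p => Lam (f r) (ofOrbit p)) 𝒰 (𝓝 (Lam (f r) (ofOrbit q)))) :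
    (𝒰 : Filter (ProductOrbit d)) ≤ 𝓝 q := by
  obtain ⟨F, hF, hvague⟩ := exists_tendsto_Lam 𝒰 id
  have hFq : X.mk F = ofOrbit q :=
    eq_of_Lam_eq hf fun r => tendsto_nhds_unique (hF (f r)) (h r)
  obtain ⟨⟨μ, ν⟩, rfl⟩ := Quotient.exists_rep q
  obtain ⟨e, he⟩ : F.SameOrbits (PairFamily.single μ ν) := Quotient.exact hFq
  let j := e.symm ⟨0, (PairFamily.single_prod_ne_zero μ ν 0).2 rfl⟩
  have hj : diagOrbit (μ : Measure (E d)) ν = diagOrbit (F.α j : Measure (E d)) (F.β j) := by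
    have := he j
    rw [Equiv.apply_symm_apply] at this
    rw [← show F.orbit j = diagOrbit (F.α j : Measure (E d)) (F.β j) from rfl, ← this]
    simp [PairFamily.orbit, PairFamily.single]
  have hmass := univ_mul_univ_of_diagOrbit_eq hj
  rw [measure_univ, measure_univ, one_mul] at hmass
  have hα : (F.α j : Measure (E d)) Set.univ = 1 :=
    (F.mass_α_le j).antisymm (hmass.trans_le (mul_le_of_le_one_right' (F.mass_β_le j)))
  have hβ : (F.β j : Measure (E d)) Set.univ = 1 :=
    (F.mass_β_le j).antisymm (hmass.trans_le (mul_le_of_le_one_left' (F.mass_α_le j)))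
  obtain ⟨a, hva, hvb⟩ := hvague j j.2
  let α' : ProbabilityMeasure (E d) := ⟨F.α j, ⟨hα⟩⟩
  let β' : ProbabilityMeasure (E d) := ⟨F.β j, ⟨hβ⟩⟩
  have h1 : Tendsto (fun p : ProductOrbit d => translateProb p.out.1 (-a p)) 𝒰 (𝓝 α') :=
    VagueLim.tendsto_probabilityMeasure hva
  have h2 : Tendsto (fun p : ProductOrbit d => translateProb p.out.2 (-a p)) 𝒰 (𝓝 β') :=
    VagueLim.tendsto_probabilityMeasure hvb
  have hmk : Continuous fun p : ProbabilityMeasure (E d) × ProbabilityMeasure (E d) =>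
      (Quotient.mk _ p : ProductOrbit d) := continuous_quot_mk
  have h3 := (hmk.tendsto (α', β')).comp (h1.prodMk_nhds h2)
  have hlim : (Quotient.mk _ (α', β') : ProductOrbit d) = Quotient.mk _ (μ, ν) :=
    Quotient.sound hj.symm
  rw [← hlim]
  refine le_trans (le_of_eq ?_) h3
  conv_lhs => rw [← map_id (f := (𝒰 : Filter (ProductOrbit d)))]
  congr 1
  exact funext fun p => (mk_translateProb p (-a p)).symm

theorem ofOrbit_injective : Function.Injective (ofOrbit (d := d)) := by
  intro q q' h
  induction q using Quotient.inductionOn with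
  | h p =>
    induction q' using Quotient.inductionOn with
    | h p' =>
      obtain ⟨e, he⟩ : (PairFamily.single p.1 p.2).SameOrbits (PairFamily.single p'.1 p'.2) :=
        Quotient.exact h
      have h0 := he ⟨0, (PairFamily.single_prod_ne_zero _ _ 0).2 rfl⟩
      rw [(PairFamily.single_prod_ne_zero _ _ _).1 (e _).2] at h0
      refine Quotient.sound (Eq.symm ?_)
      simpa [PairFamily.orbit, PairFamily.single] using h0

theorem continuous_ofOrbit {f : ℕ → TestFunction d} (hf : DenseRange f) :
    @Continuous _ _ _ (metricSpaceX f hf).toUniformSpace.toTopologicalSpace (ofOrbit (d := d)) := by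
  let _ := metricSpaceX f hf
  have h : Continuous fun p : ProbabilityMeasure (E d) × ProbabilityMeasure (E d) =>
      ofOrbit (Quotient.mk _ p) := by
    rw [continuous_iff_ultrafilter]
    intro p 𝒰 h𝒰
    rw [tendsto_iff_forall_tendsto_Lam hf]
    intro r
    rw [show Lam (f r) (ofOrbit (Quotient.mk _ p)) = _ from Lam_ofOrbit_mk (f r) p.1 p.2]
    refine Tendsto.congr (fun q => (Lam_ofOrbit_mk (f r) q.1 q.2).symm) ?_
    exact tendsto_pairIntegral_of_tendsto ((continuous_fst.tendsto p).mono_left h𝒰)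
      ((continuous_snd.tendsto p).mono_left h𝒰) (f r)
  exact h.quotient_lift _

theorem isEmbedding_ofOrbit {f : ℕ → TestFunction d} (hf : DenseRange f) :
    @IsEmbedding _ _ _ (metricSpaceX f hf).toUniformSpace.toTopologicalSpace
      (ofOrbit (d := d)) := by
  let _ := metricSpaceX f hf
  refine ⟨isInducing_iff_nhds.2 fun q => le_antisymm ?_ ?_, ofOrbit_injective⟩
  · exact ((continuous_ofOrbit hf).tendsto q).le_comap
  · rw [le_iff_ultrafilter]
    intro 𝒰 h𝒰
    exact le_nhds_of_tendsto_Lam hf 𝒰 q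
      ((tendsto_iff_forall_tendsto_Lam hf).1 (tendsto_comap.mono_left h𝒰))

/-! ### Density and compactness -/

theorem exists_subseq_tendsto {f : ℕ → TestFunction d} (hf : DenseRange f)
    (p : ℕ → ProductOrbit d) :
    ∃ (ξ : X d) (φ : ℕ → ℕ), StrictMono φ ∧ Tendsto (fun n => ofOrbit (p (φ n))) atTop
      (@nhds _ (metricSpaceX f hf).toUniformSpace.toTopologicalSpace ξ) := by
  let _ := metricSpaceX f hf
  obtain ⟨F, hF, -⟩ := exists_tendsto_Lam (hyperfilter ℕ) p
  have h1 : Tendsto (fun n => ofOrbit (p n)) (hyperfilter ℕ : Filter ℕ)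
      (𝓝 (X.mk F)) :=
    (tendsto_iff_forall_tendsto_Lam hf).2 fun r => hF (f r)
  have h2 : MapClusterPt (X.mk F) atTop
      fun n => ofOrbit (p n) :=
    (h1.mapClusterPt).mono Nat.hyperfilter_le_atTop
  obtain ⟨φ, hφ, hlim⟩ := h2.tendsto_subseq
  exact ⟨_, φ, hφ, hlim⟩

theorem denseRange_ofOrbit (hd : 1 ≤ d) {f : ℕ → TestFunction d} (hf : DenseRange f) :
    @DenseRange _ (metricSpaceX f hf).toUniformSpace.toTopologicalSpace _ (ofOrbit (d := d)) := by
  let _ := metricSpaceX f hf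
  intro ξ
  obtain ⟨F, rfl⟩ := ξ.exists_mk
  obtain ⟨μ, ν, h⟩ := exists_tendsto_pairIntegral hd F
  refine mem_closure_of_tendsto (b := (hyperfilter ℕ : Filter ℕ))
    (f := fun t => ofOrbit (Quotient.mk _ (μ t, ν t))) ?_
    (Eventually.of_forall fun t => ⟨_, rfl⟩)
  rw [tendsto_iff_forall_tendsto_Lam hf]
  intro r
  simp only [Lam_ofOrbit_mk]
  exact h (f r)

theorem compactSpace_X (hd : 1 ≤ d) {f : ℕ → TestFunction d} (hf : DenseRange f) :
    @CompactSpace _ (metricSpaceX f hf).toUniformSpace.toTopologicalSpace := by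
  let _ := metricSpaceX f hf
  refine ⟨IsSeqCompact.isCompact fun x _ => ?_⟩
  choose p hp using fun n : ℕ => Metric.denseRange_iff.1 (denseRange_ofOrbit hd hf) (x n)
    (1 / ((n : ℝ) + 1)) (by positivity)
  obtain ⟨ξ, φ, hφ, hlim⟩ := exists_subseq_tendsto hf p
  refine ⟨ξ, trivial, φ, hφ, tendsto_iff_dist_tendsto_zero.2 ?_⟩
  have h1 := (tendsto_one_div_add_atTop_nhds_zero_nat (𝕜 := ℝ)).comp hφ.tendsto_atTop
  have h2 := h1.add (tendsto_iff_dist_tendsto_zero.1 hlim)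
  rw [add_zero] at h2
  exact squeeze_zero (fun _ => dist_nonneg) (fun n => (dist_triangle _ (ofOrbit (p (φ n))) _).trans
    (add_le_add_left (hp (φ n)).le _)) h2

end PairCompactification

theorem theorem2p1 (d : ℕ) (hd : 1 ≤ d)
    (f : ℕ → PairCompactification.TestFunction d) (hf : DenseRange f) :
    ∃ m : MetricSpace (PairCompactification.X d),
      -- the metric structure is the one given by `D`
      (∀ ξ₁ ξ₂ : PairCompactification.X d, dist ξ₁ ξ₂ = PairCompactification.D f ξ₁ ξ₂) ∧
      -- every sequence of orbits of products of probability measures has a convergent subsequence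
      (∀ p : ℕ → PairCompactification.ProductOrbit d,
        ∃ (ξ : PairCompactification.X d) (φ : ℕ → ℕ), StrictMono φ ∧
          Tendsto (fun n => PairCompactification.ofOrbit (p (φ n))) atTop (𝓝 ξ)) ∧
      -- these orbits are dense
      DenseRange (PairCompactification.ofOrbit (d := d)) ∧
      -- compactification: compact, and the orbit space embeds homeomorphically
      CompactSpace (PairCompactification.X d) ∧
      IsEmbedding (PairCompactification.ofOrbit (d := d)) ∧
      -- completion: complete, and the (dense) orbit space is totally bounded
      CompleteSpace (PairCompactification.X d) ∧
      TotallyBounded (Set.range (PairCompactification.ofOrbit (d := d))) := by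
  let _ := PairCompactification.metricSpaceX f hf
  have hcompact : CompactSpace (PairCompactification.X d) :=
    PairCompactification.compactSpace_X hd hf
  exact ⟨PairCompactification.metricSpaceX f hf, fun _ _ => rfl,
    PairCompactification.exists_subseq_tendsto hf, PairCompactification.denseRange_ofOrbit hd hf,
    hcompact, PairCompactification.isEmbedding_ofOrbit hf, inferInstance,
    isCompact_univ.totallyBounded.subset (Set.subset_univ _)⟩
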